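/- Let $d,r$ be non-negative integers, $1\le p,q<\infty$, and let $L^{p,q}=L^{p,q}(\mathbb R\times\mathbb R^d)$ be the space of measurable complex functions (modulo equality a.e.) with $\|f\|_{L^{p,q}}=\big[\int_{\mathbb R}\big(\int_{\mathbb R^d}|f(x,y)|^q\,dy\big)^{p/q}dx\big]^{1/p}<\infty$. Let $W_0(L^{1,1})$ be the space of continuous $f:\mathbb R\times\mathbb R^d\to\mathbb C$ with $\sum_{n\in\mathbb Z}\sup_{x\in[0,1]}\sum_{l\in\mathbb Z^d}\sup_{y\in[0,1]^d}|f(x+n,y+l)|<\infty$, and let $\ell^{p,q}$ be the space of $c:\mathbb Z\times\mathbb Z^d\to\mathbb C$ with $\sum_{k_1}\big(\sum_{k_2}|c(k_1,k_2)|^q\big)^{p/q}<\infty$. For $\Phi=(\phi_1,\dots,\phi_r)$ with compactly supported components $\phi_i\in W_0(L^{1,1})$ let $$V_{p,q}(\Phi)=\Big\{\sum_{i=1}^r\sum_{k_1\in\mathbb Z}\sum_{k_2\in\mathbb Z^d}c_i(k_1,k_2)\,\phi_i(\cdot-k_1,\cdot-k_2):\ c_i\in\ell^{p,q}\Big\}\subset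 L^{p,q}.$$ Let $\psi\in W_0(L^{1,1})$ with $\int\psi=1$, put $\psi_a=a^{-(d+1)}\psi(\cdot/a)$ for $a>0$, and let $\langle f,g\rangle=\int f\overline g$. Let $J$ be a countable set, $x_j\in\mathbb R$ and $y_k\in\mathbb R^d$ ($j,k\in J$), and let $B_\rho(x_j,y_k)$ be the open Euclidean ball of radius $\rho$ about $(x_j,y_k)$. The set $X=\{(x_j,y_k):j,k\in J\}$ is called $\gamma$-dense if $\bigcup_{j,k}B_\rho(x_j,y_k)=\mathbb R^{d+1}$ for every $\rho>\gamma$. A bounded uniform partition of unity associated with $\{B_\rho(x_j,y_k)\}$ is a family of measurable functions $0\le\beta_{j,k}\le1$ with $\operatorname{supp}\beta_{j,k}\subset B_\rho(x_j,y_k)$ and $\sum_{j,k}\beta_{j,k}=1$ everywhere. Given such a family put $$A_{X,a}f=\sum_{j\in J}\sum_{k\in J}\langle f,\psi_a(\cdot-x_j,\cdot-y_k)\rangle\,\beta_{j,k}.$$ **Theorem.** For every $K$ there are $\gamma_0>0$, $\rho_0>\gamma_0$ and $a_0>0$, depending only on $d,p,q,\Phi,\psi,K$, such that the following holds for every bounded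 linear projection $P$ of $L^{p,q}$ onto $V_{p,q}(\Phi)$ with $\|P\|\le K$, every $\gamma\le\gamma_0$ and every $0<a\le a_0$. There is $\alpha\in[0,1)$, depending only on these data, such that for every $f\in V_{p,q}(\Phi)$ there is $M<\infty$ such that for every $\gamma$-dense set $X=\{(x_j,y_k):j,k\in J\}$: 1. for every $\rho>\gamma$ there is a bounded uniform partition of unity associated with $\{B_\rho(x_j,y_k)\}$; 2. if $\rho\le\rho_0$ and $\{\beta_{j,k}\}$ is any bounded uniform partition of unity associated with $\{B_\rho(x_j,y_k)\}$, then for every $g\in V_{p,q}(\Phi)$ the integrals and the series in $A_{X,a}g$ converge absolutely (the series at every point) and $A_{X,a}g\in L^{p,q}$; and $f$ is reconstructed from its average samples $\langle f,\psi_a(\cdot-x_j,\cdot-y_k)\rangle$, $j,k\in J$, by the iteration $$f_1=PA_{X,a}f,\qquad f_{n+1}=PA_{X,a}(f-f_n)+f_n\quad(n\ge1):$$ $f_n\to f$ in $L^{p,q}$, and $\|f-f_n\|_{L^{p,q}}\le M\alpha^n$ for all $n\ge1$. -/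

import Mathlib

open MeasureTheory Filter Topology
open scoped ENNReal

namespace MixedSampling

/-- Euclidean space `ℝ^{d+1}`, written as `ℝ × ℝ^d`, with Lebesgue measure. Its points are
`(x, y)`. (Euclidean distances on it are written out explicitly below, since the metric of a
product type is the maximum metric.) -/
abbrev E (d : ℕ) : Type := ℝ × EuclideanSpace ℝ (Fin d)

/-- The integer lattice `ℤ^{d+1} = ℤ × ℤ^d`. -/
abbrev Lat (d : ℕ) : Type := ℤ × (Fin d → ℤ)

/-- A lattice point, seen as a point of `ℝ^{d+1}`. -/
def Lat.toE {d : ℕ} (k : Lat d) : E d := ((k.1 : ℝ), WithLp.toLp 2 fun i => (k.2 i : ℝ))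

/-! ### Mixed Lebesgue spaces -/

/-- `(∫ (∫ |f(x,y)|^q dy)^{p/q} dx)^{1/p}`, as an element of `[0, ∞]`. -/
noncomputable def mixedNorm {d : ℕ} (p q : ℝ) (f : E d → ℂ) : ℝ≥0∞ :=
  (∫⁻ x : ℝ, (∫⁻ y : EuclideanSpace ℝ (Fin d), ‖f (x, y)‖ₑ ^ q) ^ (p / q)) ^ (1 / p)

/-- The function `f` is (a.e. equal to) a measurable function with finite mixed norm. -/
def MemLpq {d : ℕ} (p q : ℝ) (f : E d → ℂ) : Prop :=
  AEStronglyMeasurable f (volume : Measure (E d)) ∧ mixedNorm p q f < ∞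

theorem mixedNorm_congr {d : ℕ} (p q : ℝ) {f g : E d → ℂ}
    (h : f =ᵐ[(volume : Measure (E d))] g) : mixedNorm p q f = mixedNorm p q g := by
  unfold mixedNorm
  congr 1
  apply lintegral_congr_ae
  have h' := Measure.ae_ae_of_ae_prod (μ := (volume : Measure ℝ))
    (ν := (volume : Measure (EuclideanSpace ℝ (Fin d)))) h
  filter_upwards [h'] with x hx
  congr 1
  apply lintegral_congr_ae
  filter_upwards [hx] with y hy
  rw [hy]

theorem mixedNorm_zero {d : ℕ} {p q : ℝ} (hp : 1 ≤ p) (hq : 1 ≤ q) :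
    mixedNorm p q (0 : E d → ℂ) = 0 := by
  have hp' : 0 < p := by linarith
  have hq' : 0 < q := by linarith
  simp [mixedNorm, hp', hq', ENNReal.zero_rpow_of_pos, div_pos hp' hq']

theorem mixedNorm_smul {d : ℕ} {p q : ℝ} (hp : 1 ≤ p) (hq : 1 ≤ q) (c : ℂ) (f : E d → ℂ) :
    mixedNorm p q (c • f) = ‖c‖ₑ * mixedNorm p q f := by
  have hp' : 0 < p := by linarith
  have hq' : 0 < q := by linarith
  unfold mixedNorm
  simp only [Pi.smul_apply, enorm_smul, ENNReal.mul_rpow_of_nonneg _ _ hq'.le]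
  have h1 : ‖c‖ₑ ^ q ≠ ∞ := ENNReal.rpow_ne_top_of_nonneg hq'.le enorm_ne_top
  simp only [lintegral_const_mul' _ _ h1, ENNReal.mul_rpow_of_nonneg _ _ (div_pos hp' hq').le]
  have h2 : (‖c‖ₑ ^ q) ^ (p / q) = ‖c‖ₑ ^ p := by
    rw [← ENNReal.rpow_mul]; congr 1; field_simp
  rw [h2]
  have h3 : ‖c‖ₑ ^ p ≠ ∞ := ENNReal.rpow_ne_top_of_nonneg hp'.le enorm_ne_top
  rw [lintegral_const_mul' _ _ h3, ENNReal.mul_rpow_of_nonneg _ _ (by positivity),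
    ← ENNReal.rpow_mul]
  congr 1
  rw [mul_one_div_cancel hp'.ne', ENNReal.rpow_one]

theorem mixedNorm_add_le_of_meas {d : ℕ} {p q : ℝ} (hp : 1 ≤ p) (hq : 1 ≤ q) {f g : E d → ℂ}
    (hf : Measurable f) (hg : Measurable g) :
    mixedNorm p q (f + g) ≤ mixedNorm p q f + mixedNorm p q g := by
  have hp' : 0 < p := by linarith
  have hq' : 0 < q := by linarith
  have key : ∀ h : E d → ℂ, mixedNorm p q h =
      (∫⁻ x : ℝ, ((∫⁻ y : EuclideanSpace ℝ (Fin d), ‖h (x, y)‖ₑ ^ q) ^ (1 / q)) ^ p)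
        ^ (1 / p) := by
    intro h
    unfold mixedNorm
    congr 1
    apply lintegral_congr
    intro x
    rw [← ENNReal.rpow_mul]
    congr 1
    field_simp
  have hm : ∀ h : E d → ℂ, Measurable h → Measurable fun x : ℝ =>
      (∫⁻ y : EuclideanSpace ℝ (Fin d), ‖h (x, y)‖ₑ ^ q) ^ (1 / q) := by
    intro h hh
    have : Measurable fun z : E d => ‖h z‖ₑ ^ q := hh.enorm.pow_const q
    exact this.lintegral_prod_right'.pow_const _
  rw [key f, key g, key (f + g)]
  refine le_trans ?_ (ENNReal.lintegral_Lp_add_le (hm f hf).aemeasurable (hm g hg).aemeasurable hp)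
  apply ENNReal.rpow_le_rpow _ (by positivity)
  apply lintegral_mono
  intro x
  apply ENNReal.rpow_le_rpow _ hp'.le
  have hfx : Measurable fun y : EuclideanSpace ℝ (Fin d) => ‖f (x, y)‖ₑ :=
    (hf.comp measurable_prodMk_left).enorm
  have hgx : Measurable fun y : EuclideanSpace ℝ (Fin d) => ‖g (x, y)‖ₑ :=
    (hg.comp measurable_prodMk_left).enorm
  refine le_trans ?_ (ENNReal.lintegral_Lp_add_le hfx.aemeasurable hgx.aemeasurable hq)
  apply ENNReal.rpow_le_rpow _ (by positivity)
  apply lintegral_mono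
  intro y
  exact ENNReal.rpow_le_rpow (enorm_add_le _ _) hq'.le

theorem mixedNorm_add_le {d : ℕ} {p q : ℝ} (hp : 1 ≤ p) (hq : 1 ≤ q) {f g : E d → ℂ}
    (hf : AEStronglyMeasurable f (volume : Measure (E d)))
    (hg : AEStronglyMeasurable g (volume : Measure (E d))) :
    mixedNorm p q (f + g) ≤ mixedNorm p q f + mixedNorm p q g := by
  rw [mixedNorm_congr p q hf.ae_eq_mk, mixedNorm_congr p q hg.ae_eq_mk,
    mixedNorm_congr p q (hf.ae_eq_mk.add hg.ae_eq_mk)]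
  exact mixedNorm_add_le_of_meas hp hq hf.stronglyMeasurable_mk.measurable
    hg.stronglyMeasurable_mk.measurable

theorem ae_eq_zero_of_mixedNorm_eq_zero {d : ℕ} {p q : ℝ} (hp : 1 ≤ p) (hq : 1 ≤ q)
    {f : E d → ℂ} (hf : AEStronglyMeasurable f (volume : Measure (E d)))
    (h : mixedNorm p q f = 0) : f =ᵐ[(volume : Measure (E d))] 0 := by
  have hp' : 0 < p := by linarith
  have hq' : 0 < q := by linarith
  rw [mixedNorm_congr p q hf.ae_eq_mk] at h
  refine hf.ae_eq_mk.trans ?_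
  have hg : Measurable (hf.mk f) := hf.stronglyMeasurable_mk.measurable
  generalize hf.mk f = g at h hg
  have hgm : Measurable fun z : E d => ‖g z‖ₑ ^ q := hg.enorm.pow_const q
  unfold mixedNorm at h
  rw [ENNReal.rpow_eq_zero_iff_of_pos (by positivity),
    lintegral_eq_zero_iff (hgm.lintegral_prod_right'.pow_const _)] at h
  have h0 : ∫⁻ z : E d, ‖g z‖ₑ ^ q = 0 := by
    rw [Measure.volume_eq_prod, lintegral_prod _ hgm.aemeasurable,
      lintegral_eq_zero_iff hgm.lintegral_prod_right']
    filter_upwards [h] with x hx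
    simpa [ENNReal.rpow_eq_zero_iff_of_pos (div_pos hp' hq')] using hx
  rw [lintegral_eq_zero_iff hgm] at h0
  filter_upwards [h0] with z hz
  simpa [ENNReal.rpow_eq_zero_iff_of_pos hq'] using hz

/-- The mixed Lebesgue space `L^{p,q}(ℝ^{d+1})`: classes of measurable functions, modulo equality
almost everywhere, with finite mixed norm. -/
def Lpq (d : ℕ) (p q : ℝ) [hp : Fact (1 ≤ p)] [hq : Fact (1 ≤ q)] :
    Submodule ℂ (E d →ₘ[(volume : Measure (E d))] ℂ) where
  carrier := {f | mixedNorm p q (f : E d → ℂ) < ∞}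
  zero_mem' := by
    change mixedNorm p q _ < ∞
    rw [mixedNorm_congr p q (AEEqFun.coeFn_zero (μ := (volume : Measure (E d)))),
      mixedNorm_zero hp.out hq.out]
    exact ENNReal.zero_lt_top
  add_mem' := by
    intro f g hf hg
    change mixedNorm p q _ < ∞
    rw [mixedNorm_congr p q (AEEqFun.coeFn_add f g)]
    exact (mixedNorm_add_le hp.out hq.out f.aestronglyMeasurable g.aestronglyMeasurable).trans_lt
      (ENNReal.add_lt_top.2 ⟨hf, hg⟩)
  smul_mem' := by
    intro c f hf
    change mixedNorm p q _ < ∞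
    rw [mixedNorm_congr p q (AEEqFun.coeFn_smul c f), mixedNorm_smul hp.out hq.out]
    exact ENNReal.mul_lt_top enorm_lt_top hf

section Norm

variable {d : ℕ} {p q : ℝ} [hp : Fact (1 ≤ p)] [hq : Fact (1 ≤ q)]

noncomputable instance Lpq.instNorm : Norm (Lpq d p q) :=
  ⟨fun f => (mixedNorm p q ((f : E d →ₘ[(volume : Measure (E d))] ℂ) : E d → ℂ)).toReal⟩

theorem Lpq.norm_def (f : Lpq d p q) :
    ‖f‖ = (mixedNorm p q ((f : E d →ₘ[(volume : Measure (E d))] ℂ) : E d → ℂ)).toReal := rfl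

theorem Lpq.core : NormedSpace.Core ℂ (Lpq d p q) where
  norm_nonneg f := ENNReal.toReal_nonneg
  norm_smul c f := by
    rw [Lpq.norm_def, Lpq.norm_def, Submodule.coe_smul,
      mixedNorm_congr p q (AEEqFun.coeFn_smul c f.1), mixedNorm_smul hp.out hq.out,
      ENNReal.toReal_mul, toReal_enorm]
  norm_triangle f g := by
    rw [Lpq.norm_def, Lpq.norm_def, Lpq.norm_def, Submodule.coe_add,
      mixedNorm_congr p q (AEEqFun.coeFn_add f.1 g.1), ← ENNReal.toReal_add f.2.ne g.2.ne]
    exact ENNReal.toReal_mono (ENNReal.add_lt_top.2 ⟨f.2, g.2⟩).ne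
      (mixedNorm_add_le hp.out hq.out f.1.aestronglyMeasurable g.1.aestronglyMeasurable)
  norm_eq_zero_iff f := by
    rw [Lpq.norm_def, ENNReal.toReal_eq_zero_iff, or_iff_left f.2.ne]
    constructor
    · intro h
      apply Subtype.ext
      apply AEEqFun.ext
      exact (ae_eq_zero_of_mixedNorm_eq_zero hp.out hq.out f.1.aestronglyMeasurable h).trans
        (AEEqFun.coeFn_zero (μ := (volume : Measure (E d)))).symm
    · rintro rfl
      rw [Submodule.coe_zero,
        mixedNorm_congr p q (AEEqFun.coeFn_zero (μ := (volume : Measure (E d)))),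
        mixedNorm_zero hp.out hq.out]

noncomputable instance Lpq.instNormedAddCommGroup : NormedAddCommGroup (Lpq d p q) :=
  NormedAddCommGroup.ofCore (𝕜 := ℂ) Lpq.core

noncomputable instance Lpq.instNormedSpace : NormedSpace ℂ (Lpq d p q) :=
  NormedSpace.ofCore Lpq.core

/-- Elements of `L^{p,q}` are used as functions (through a representative). -/
noncomputable instance Lpq.instCoeFun : CoeFun (Lpq d p q) fun _ => E d → ℂ :=
  ⟨fun f => ((f : E d →ₘ[(volume : Measure (E d))] ℂ) : E d → ℂ)⟩

/-- The class in `L^{p,q}` of a function with finite mixed norm. -/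
noncomputable def MemLpq.toLpq {f : E d → ℂ} (hf : MemLpq p q f) : Lpq d p q :=
  ⟨AEEqFun.mk f hf.1, by
    change mixedNorm p q _ < ∞
    rw [mixedNorm_congr p q (AEEqFun.coeFn_mk f hf.1)]
    exact hf.2⟩

end Norm

/-- Membership of a family `c` on `ℤ^{d+1}` in the mixed sequence space `ℓ^{p,q}`. -/
def MemSeq {d : ℕ} (p q : ℝ) (c : Lat d → ℂ) : Prop :=
  ∑' k₁ : ℤ, (∑' k₂ : Fin d → ℤ, ‖c (k₁, k₂)‖ₑ ^ q) ^ (p / q) < ∞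

/-! ### Mixed Wiener amalgam spaces and shift-invariant spaces -/

/-- The `p`-th power of the norm of the mixed Wiener amalgam space `W(L^{p,q})`. -/
noncomputable def wienerSum {d : ℕ} (p q : ℝ) (f : E d → ℂ) : ℝ≥0∞ :=
  ∑' n : ℤ, ⨆ x ∈ Set.Icc (0 : ℝ) 1,
    (∑' l : Fin d → ℤ, ⨆ y ∈ {y : EuclideanSpace ℝ (Fin d) | ∀ i, y i ∈ Set.Icc (0 : ℝ) 1},
      ‖f ((x, y) + Lat.toE (n, l))‖ₑ ^ q) ^ (p / q)

/-- Membership in `W_0(L^{p,q})`: continuous functions in `W(L^{p,q})`. -/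
def MemW0 {d : ℕ} (p q : ℝ) (f : E d → ℂ) : Prop :=
  Continuous f ∧ wienerSum p q f < ∞

/-- The multiply generated shift-invariant space `V_{p,q}(Φ)` in `L^{p,q}`. -/
def shiftInvSpace {d r : ℕ} (p q : ℝ) [Fact (1 ≤ p)] [Fact (1 ≤ q)] (Φ : Fin r → E d → ℂ) :
    Set (Lpq d p q) :=
  {f | ∃ c : Fin r → Lat d → ℂ, (∀ i, MemSeq p q (c i)) ∧
    (f : E d → ℂ) =ᵐ[(volume : Measure (E d))]
      fun t => ∑ i, ∑' k : Lat d, c i k * Φ i (t - k.toE)}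

/-- `P` is a projection of the normed space onto the subset `V`. -/
def IsProjectionOnto {F : Type*} [NormedAddCommGroup F] [NormedSpace ℂ F]
    (P : F →L[ℂ] F) (V : Set F) : Prop :=
  (∀ f, P (P f) = P f) ∧ Set.range P = V

/-! ### Sampling sets, partitions of unity and averages -/

/-- The open Euclidean ball of `ℝ^{d+1}` with centre `(x, y)` and radius `γ`. -/
def eball {d : ℕ} (x : ℝ) (y : EuclideanSpace ℝ (Fin d)) (γ : ℝ) : Set (E d) :=
  {t | √((t.1 - x) ^ 2 + ‖t.2 - y‖ ^ 2) < γ}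

/-- The set `{(x_j, y_k)}` is `γ₀`-dense: for every `γ > γ₀`, the open balls of radius `γ` about
its points cover the space. -/
def IsDenseSampling {d : ℕ} {J : Type*} (γ₀ : ℝ) (x : J → ℝ)
    (y : J → EuclideanSpace ℝ (Fin d)) : Prop :=
  ∀ γ > γ₀, ⋃ j, ⋃ k, eball (x j) (y k) γ = Set.univ

/-- `β` is a bounded uniform partition of unity associated with the balls of radius `ρ` about the
points `(x_j, y_k)`. -/
structure IsBUPU {d : ℕ} {J : Type*} (ρ : ℝ) (x : J → ℝ) (y : J → EuclideanSpace ℝ (Fin d))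
    (β : J → J → E d → ℝ) : Prop where
  measurable : ∀ j k, Measurable (β j k)
  nonneg : ∀ j k t, 0 ≤ β j k t
  le_one : ∀ j k t, β j k t ≤ 1
  tsupport_subset : ∀ j k, tsupport (β j k) ⊆ eball (x j) (y k) ρ
  hasSum_one : ∀ t, HasSum (fun jk : J × J => β jk.1 jk.2 t) 1

/-- The dilation `ψ_a = a^{-(d+1)} ψ(·/a)`. -/
noncomputable def dilate {d : ℕ} (a : ℝ) (ψ : E d → ℂ) (t : E d) : ℂ :=
  ((1 / a ^ (d + 1) : ℝ) : ℂ) * ψ ((1 / a) • t)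

/-- The integrand of the average sample `⟨f, ψ_a(· - x, · - y)⟩`. -/
noncomputable def sampleIntegrand {d : ℕ} (a : ℝ) (ψ : E d → ℂ) (f : E d → ℂ) (x : ℝ)
    (y : EuclideanSpace ℝ (Fin d)) (t : E d) : ℂ :=
  f t * (starRingEnd ℂ) (dilate a ψ (t - (x, y)))

/-- The average sample `⟨f, ψ_a(· - x, · - y)⟩`. -/
noncomputable def sample {d : ℕ} (a : ℝ) (ψ : E d → ℂ) (f : E d → ℂ) (x : ℝ)
    (y : EuclideanSpace ℝ (Fin d)) : ℂ :=
  ∫ t, sampleIntegrand a ψ f x y t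

/-- The function `A_{X,a} f = ∑_{j,k} ⟨f, ψ_a(· - x_j, · - y_k)⟩ β_{j,k}`. -/
noncomputable def avgFun {d : ℕ} {J : Type*} (a : ℝ) (ψ : E d → ℂ) (x : J → ℝ)
    (y : J → EuclideanSpace ℝ (Fin d)) (β : J → J → E d → ℝ) (f : E d → ℂ) (t : E d) : ℂ :=
  ∑' jk : J × J, sample a ψ f (x jk.1) (y jk.2) * (β jk.1 jk.2 t : ℂ)

/-- `A_{X,a} f` is meaningful as an element of `L^{p,q}`: the integrals that define the samples
converge absolutely, the series converges absolutely at every point, and its sum is in `L^{p,q}`. -/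
structure AvgDefined {d : ℕ} {J : Type*} (p q : ℝ) (a : ℝ) (ψ : E d → ℂ) (x : J → ℝ)
    (y : J → EuclideanSpace ℝ (Fin d)) (β : J → J → E d → ℝ) (f : E d → ℂ) : Prop where
  integrable : ∀ j k, Integrable (sampleIntegrand a ψ f (x j) (y k))
  summable : ∀ t, Summable fun jk : J × J =>
    sample a ψ f (x jk.1) (y jk.2) * (β jk.1 jk.2 t : ℂ)
  memLpq : MemLpq p q (avgFun a ψ x y β f)

open Classical in
/-- The operator `A_{X,a}` with values in `L^{p,q}`; it takes the placeholder value `0` where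
`A_{X,a} f` is not defined as an element of `L^{p,q}`. -/
noncomputable def avgOp {d : ℕ} {J : Type*} {p q : ℝ} [Fact (1 ≤ p)] [Fact (1 ≤ q)] (a : ℝ)
    (ψ : E d → ℂ) (x : J → ℝ) (y : J → EuclideanSpace ℝ (Fin d)) (β : J → J → E d → ℝ)
    (f : Lpq d p q) : Lpq d p q :=
  if h : AvgDefined p q a ψ x y β f then h.memLpq.toLpq else 0

end MixedSampling

namespace MixedSampling

/-! On $V=V_{p,q}(\Phi)$ the operator $PA_{X,a}$ is close to the identity, so the iteration is a
Neumann series. Since $P$ fixes $V$, $g-PA_{X,a}g=P(g-A_{X,a}g)$ for $g\in V$, and the error obeys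
$f-f_{n+1}=(I-PA_{X,a})(f-f_n)$ without leaving $V$. It suffices that
$\|A_{X,a}g-g\|\le\frac1{2K'}\|g\|$ on $V$ with $K'=|K|+1$, uniformly in $X$ and $\beta$; this gives
the rate $1/2$ (`tendsto_and_norm_sub_le_of_contraction`).

Write $g=\sum_i\sum_k c_i(k)\phi_i(\cdot-k)$. At $t$, $A_{X,a}g(t)$ is a convex combination of
samples at points $z$ within $\rho$ of $t$, and each sample differs from $g(t)$ by
$\int(g(z+au)-g(t))\overline{\psi(u)}\,du$. Cut the $u$-space into unit lattice cells. On finitely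
many cells $au$ is small, and uniform continuity of the $\phi_i$ bounds the difference by
$\varepsilon$ times a local sum of $|c_i|$ near $t$. On the other cells the difference is bounded by
two such local sums, one of them translated by $a$ times the cell index, but $|\psi|$ has small mass
there. Minkowski's inequality and translation invariance of the mixed norm turn this into
$\|A_{X,a}g-g\|\le\tau\|c\|$ (`mixedLNorm_tsum_oscBound_le`, `exists_avgOp_sub_norm_le`).

Finally $\|c\|$ must be controlled by $\|g\|$. The range of a bounded projection is closed, hence
$V$ is a Banach space, and the open mapping theorem for the synthesis map $c\mapsto g$ provides
coefficients with $\|c\|\le C\|g\|$ (`exists_coeff_norm_le`). This needs completeness of $L^{p,q}$,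
which is proved by hand. -/

/-- The mixed norm of a function with values in `[0, ∞]`. -/
noncomputable def mixedLNorm {d : ℕ} (p q : ℝ) (F : E d → ℝ≥0∞) : ℝ≥0∞ :=
  (∫⁻ x : ℝ, (∫⁻ y : EuclideanSpace ℝ (Fin d), F (x, y) ^ q) ^ (p / q)) ^ (1 / p)

/-! ### Mixed norms of nonnegative functions: Minkowski and translation invariance. -/

section MixedLNorm

variable {d : ℕ} {p q : ℝ}

theorem mixedLNorm_mono_ae (hp : 1 ≤ p) (hq : 1 ≤ q) {F G : E d → ℝ≥0∞}
    (h : ∀ᵐ t, F t ≤ G t) : mixedLNorm p q F ≤ mixedLNorm p q G := by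
  have hp' : 0 < p := by linarith
  have hq' : 0 < q := by linarith
  refine ENNReal.rpow_le_rpow (lintegral_mono_ae ?_) (by positivity)
  have h' := Measure.ae_ae_of_ae_prod (μ := (volume : Measure ℝ))
    (ν := (volume : Measure (EuclideanSpace ℝ (Fin d)))) h
  filter_upwards [h'] with x hx
  refine ENNReal.rpow_le_rpow (lintegral_mono_ae ?_) (by positivity)
  filter_upwards [hx] with y hy
  exact ENNReal.rpow_le_rpow hy hq'.le

theorem mixedLNorm_mono (hp : 1 ≤ p) (hq : 1 ≤ q) {F G : E d → ℝ≥0∞}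
    (h : ∀ t, F t ≤ G t) : mixedLNorm p q F ≤ mixedLNorm p q G :=
  mixedLNorm_mono_ae hp hq (ae_of_all _ h)

theorem measurable_inner_lintegral {F : E d → ℝ≥0∞} (hF : Measurable F) :
    Measurable fun x : ℝ => ∫⁻ y : EuclideanSpace ℝ (Fin d), F (x, y) ^ q := by
  have : Measurable fun z : E d => F z ^ q := hF.pow_const q
  exact this.lintegral_prod_right'

theorem mixedLNorm_const_mul (hp : 1 ≤ p) (hq : 1 ≤ q) (c : ℝ≥0∞) {F : E d → ℝ≥0∞}
    (hF : Measurable F) :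
    mixedLNorm p q (fun t => c * F t) = c * mixedLNorm p q F := by
  have hp' : 0 < p := by linarith
  have hq' : 0 < q := by linarith
  have hm (x : ℝ) : Measurable fun y : EuclideanSpace ℝ (Fin d) => F (x, y) ^ q :=
    (hF.comp measurable_prodMk_left).pow_const q
  unfold mixedLNorm
  simp only [ENNReal.mul_rpow_of_nonneg _ _ hq'.le]
  have h1 (x : ℝ) : ∫⁻ y : EuclideanSpace ℝ (Fin d), c ^ q * F (x, y) ^ q =
      c ^ q * ∫⁻ y : EuclideanSpace ℝ (Fin d), F (x, y) ^ q := lintegral_const_mul _ (hm x)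
  simp only [h1, ENNReal.mul_rpow_of_nonneg _ _ (div_pos hp' hq').le]
  rw [lintegral_const_mul _ ((measurable_inner_lintegral hF).pow_const _),
    ENNReal.mul_rpow_of_nonneg _ _ (by positivity), ← ENNReal.rpow_mul, ← ENNReal.rpow_mul]
  congr 1
  have : q * (p / q * (1 / p)) = 1 := by field_simp
  rw [this, ENNReal.rpow_one]

theorem mixedLNorm_add_le (hp : 1 ≤ p) (hq : 1 ≤ q) {F G : E d → ℝ≥0∞}
    (hF : Measurable F) (hG : Measurable G) :
    mixedLNorm p q (fun t => F t + G t) ≤ mixedLNorm p q F + mixedLNorm p q G := by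
  have hp' : 0 < p := by linarith
  have hq' : 0 < q := by linarith
  have key : ∀ h : E d → ℝ≥0∞, mixedLNorm p q h =
      (∫⁻ x : ℝ, ((∫⁻ y : EuclideanSpace ℝ (Fin d), h (x, y) ^ q) ^ (1 / q)) ^ p)
        ^ (1 / p) := by
    intro h
    unfold mixedLNorm
    congr 1
    refine lintegral_congr fun x => ?_
    rw [← ENNReal.rpow_mul]
    congr 1
    field_simp
  rw [key F, key G, key]
  refine le_trans ?_ (ENNReal.lintegral_Lp_add_le
    ((measurable_inner_lintegral hF).pow_const _).aemeasurable
    ((measurable_inner_lintegral hG).pow_const _).aemeasurable hp)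
  refine ENNReal.rpow_le_rpow (lintegral_mono fun x => ENNReal.rpow_le_rpow ?_ hp'.le)
    (by positivity)
  exact ENNReal.lintegral_Lp_add_le (hF.comp measurable_prodMk_left).aemeasurable
    (hG.comp measurable_prodMk_left).aemeasurable hq

theorem mixedLNorm_zero (hp : 1 ≤ p) (hq : 1 ≤ q) :
    mixedLNorm p q (fun _ : E d => 0) = 0 := by
  have hp' : 0 < p := by linarith
  have hq' : 0 < q := by linarith
  simp [mixedLNorm, hp', hq', ENNReal.zero_rpow_of_pos, div_pos hp' hq']

theorem mixedLNorm_sum_le (hp : 1 ≤ p) (hq : 1 ≤ q) {ι : Type*} (s : Finset ι)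
    {F : ι → E d → ℝ≥0∞} (hF : ∀ i, Measurable (F i)) :
    mixedLNorm p q (fun t => ∑ i ∈ s, F i t) ≤ ∑ i ∈ s, mixedLNorm p q (F i) := by
  classical
  induction s using Finset.induction_on with
  | empty => simp [mixedLNorm_zero hp hq]
  | insert i s hi ih =>
    simp only [Finset.sum_insert hi]
    refine (mixedLNorm_add_le hp hq (hF i) (Finset.measurable_fun_sum s fun i _ => hF i)).trans ?_
    gcongr

theorem iSup_rpow {ι : Sort*} (f : ι → ℝ≥0∞) {s : ℝ} (hs : 0 < s) :
    (⨆ i, f i) ^ s = ⨆ i, f i ^ s :=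
  (ENNReal.orderIsoRpow s hs).map_iSup f

/-- Monotone convergence, applied in $y$ and then in $x$; positive powers commute with suprema
because they are order isomorphisms of $[0,\infty]$. -/
theorem mixedLNorm_iSup_directed (hp : 1 ≤ p) (hq : 1 ≤ q) {ι : Type*} [Countable ι]
    {F : ι → E d → ℝ≥0∞} (hF : ∀ i, Measurable (F i)) (hd : Directed (· ≤ ·) F) :
    mixedLNorm p q (fun t => ⨆ i, F i t) = ⨆ i, mixedLNorm p q (F i) := by
  have hp' : 0 < p := by linarith
  have hq' : 0 < q := by linarith
  unfold mixedLNorm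
  simp only [iSup_rpow _ hq']
  have h1 (x : ℝ) : ∫⁻ y : EuclideanSpace ℝ (Fin d), ⨆ i, F i (x, y) ^ q =
      ⨆ i, ∫⁻ y : EuclideanSpace ℝ (Fin d), F i (x, y) ^ q := by
    refine lintegral_iSup_directed_of_measurable
      (fun i => ((hF i).comp measurable_prodMk_left).pow_const q) fun i j => ?_
    obtain ⟨k, hk1, hk2⟩ := hd i j
    exact ⟨k, fun y => ENNReal.rpow_le_rpow (hk1 _) hq'.le,
      fun y => ENNReal.rpow_le_rpow (hk2 _) hq'.le⟩
  simp only [h1, iSup_rpow _ (div_pos hp' hq')]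
  rw [lintegral_iSup_directed_of_measurable, iSup_rpow _ (by positivity)]
  · exact fun i => (measurable_inner_lintegral (hF i)).pow_const _
  · intro i j
    obtain ⟨k, hk1, hk2⟩ := hd i j
    exact ⟨k,
      fun x => ENNReal.rpow_le_rpow
        (lintegral_mono fun y => ENNReal.rpow_le_rpow (hk1 _) hq'.le) (by positivity),
      fun x => ENNReal.rpow_le_rpow
        (lintegral_mono fun y => ENNReal.rpow_le_rpow (hk2 _) hq'.le) (by positivity)⟩

/-- Countable Minkowski inequality: the sum is the directed supremum of its finite partial sums. -/
theorem mixedLNorm_tsum_le (hp : 1 ≤ p) (hq : 1 ≤ q) {ι : Type*} [Countable ι]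
    {F : ι → E d → ℝ≥0∞} (hF : ∀ i, Measurable (F i)) :
    mixedLNorm p q (fun t => ∑' i, F i t) ≤ ∑' i, mixedLNorm p q (F i) := by
  classical
  simp only [ENNReal.tsum_eq_iSup_sum]
  rw [mixedLNorm_iSup_directed hp hq (F := fun (s : Finset ι) t => ∑ i ∈ s, F i t)
    (fun s => Finset.measurable_fun_sum s fun i _ => hF i)]
  · exact iSup_mono fun s => mixedLNorm_sum_le hp hq s hF
  · intro s s'
    exact ⟨s ∪ s', fun t => Finset.sum_le_sum_of_subset Finset.subset_union_left,
      fun t => Finset.sum_le_sum_of_subset Finset.subset_union_right⟩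

theorem mixedLNorm_comp_add (F : E d → ℝ≥0∞) (v : E d) :
    mixedLNorm p q (fun t => F (t + v)) = mixedLNorm p q F := by
  unfold mixedLNorm
  have h1 (x : ℝ) : ∫⁻ y : EuclideanSpace ℝ (Fin d), F ((x, y) + v) ^ q =
      ∫⁻ y : EuclideanSpace ℝ (Fin d), F (x + v.1, y) ^ q :=
    lintegral_add_right_eq_self (fun y : EuclideanSpace ℝ (Fin d) => F (x + v.1, y) ^ q) v.2
  simp only [h1]
  rw [lintegral_add_right_eq_self (fun x : ℝ =>
    (∫⁻ y : EuclideanSpace ℝ (Fin d), F (x, y) ^ q) ^ (p / q)) v.1]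

theorem ae_lt_top_of_mixedLNorm_lt_top (hp : 1 ≤ p) (hq : 1 ≤ q) {F : E d → ℝ≥0∞}
    (hF : Measurable F) (h : mixedLNorm p q F < ∞) : ∀ᵐ t, F t < ∞ := by
  have hp' : 0 < p := by linarith
  have hq' : 0 < q := by linarith
  have hpq : 0 < p / q := div_pos hp' hq'
  have h1 : ∫⁻ x : ℝ, (∫⁻ y : EuclideanSpace ℝ (Fin d), F (x, y) ^ q) ^ (p / q) < ∞ :=
    (ENNReal.rpow_lt_top_iff_of_pos (by positivity)).1 h
  have h2 := ae_lt_top ((measurable_inner_lintegral hF).pow_const _) h1.ne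
  change ∀ᵐ t ∂(volume.prod volume), t ∈ {t | F t < ∞}
  rw [Measure.ae_prod_mem_iff_ae_ae_mem (measurableSet_lt hF measurable_const)]
  filter_upwards [h2] with x hx
  have h3 := ae_lt_top ((hF.comp measurable_prodMk_left).pow_const q)
    ((ENNReal.rpow_lt_top_iff_of_pos hpq).1 hx).ne
  filter_upwards [h3] with y hy
  exact (ENNReal.rpow_lt_top_iff_of_pos hq').1 hy

end MixedLNorm

/-! ### Functions constant on unit lattice cells. -/

section Floor

variable {d : ℕ}

/-- The coordinatewise integer part. -/
noncomputable def latFloor (t : E d) : Lat d := (⌊t.1⌋, fun i => ⌊t.2 i⌋)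

theorem measurable_floor_euclidean :
    Measurable fun (y : EuclideanSpace ℝ (Fin d)) (i : Fin d) => ⌊y i⌋ := by
  refine measurable_pi_lambda _ fun i => Int.measurable_floor.comp ?_
  fun_prop

theorem measurable_latFloor : Measurable (latFloor : E d → Lat d) :=
  (Int.measurable_floor.comp measurable_fst).prodMk
    (measurable_floor_euclidean.comp measurable_snd)

theorem lintegral_comp_floor (h : ℤ → ℝ≥0∞) : ∫⁻ x : ℝ, h ⌊x⌋ = ∑' n, h n := by
  rw [← lintegral_map (μ := volume) (f := h) (g := fun x : ℝ => ⌊x⌋) (by fun_prop)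
    Int.measurable_floor, lintegral_countable']
  refine tsum_congr fun n => ?_
  rw [Measure.map_apply Int.measurable_floor (measurableSet_singleton n)]
  rw [Int.preimage_floor_singleton]
  simp

theorem lintegral_comp_floor_euclidean (h : (Fin d → ℤ) → ℝ≥0∞) :
    ∫⁻ y : EuclideanSpace ℝ (Fin d), h (fun i => ⌊y i⌋) = ∑' l, h l := by
  rw [← lintegral_map (μ := volume) (f := h) (measurable_of_countable _)
    measurable_floor_euclidean, lintegral_countable']
  refine tsum_congr fun l => ?_
  rw [Measure.map_apply measurable_floor_euclidean (measurableSet_singleton l)]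
  have : (fun (y : EuclideanSpace ℝ (Fin d)) (i : Fin d) => ⌊y i⌋) ⁻¹' {l} =
      WithLp.ofLp ⁻¹' Set.univ.pi fun i => Set.Ico (l i : ℝ) (l i + 1) := by
    ext y
    simp [funext_iff, Int.floor_eq_iff]
  rw [this, (PiLp.volume_preserving_ofLp (Fin d)).measure_preimage
    (MeasurableSet.univ_pi fun i => measurableSet_Ico).nullMeasurableSet, volume_pi_pi]
  simp

/-- The cells have measure one in each variable, so cellwise constant functions carry the norm of
$\ell^{p,q}$. This is the bridge from coefficients to functions. -/
theorem mixedLNorm_comp_latFloor {p q : ℝ} (h : Lat d → ℝ≥0∞) :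
    mixedLNorm p q (fun t => h (latFloor t)) =
      (∑' k₁ : ℤ, (∑' k₂ : Fin d → ℤ, h (k₁, k₂) ^ q) ^ (p / q)) ^ (1 / p) := by
  unfold mixedLNorm
  simp only [latFloor]
  simp only [fun x : ℝ => lintegral_comp_floor_euclidean (d := d) fun l => h (⌊x⌋, l) ^ q]
  rw [lintegral_comp_floor fun n => (∑' l, h (n, l) ^ q) ^ (p / q)]

end Floor

/-! ### Completeness of the mixed Lebesgue space. -/

section Complete

variable {d : ℕ} {p q : ℝ} [hp : Fact (1 ≤ p)] [hq : Fact (1 ≤ q)]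

theorem Lpq.ofReal_norm (f : Lpq d p q) : ENNReal.ofReal ‖f‖ = mixedNorm p q f :=
  ENNReal.ofReal_toReal f.2.ne

theorem Lpq.norm_le_of_ae_enorm_le {f : Lpq d p q} {G : E d → ℝ≥0∞} {C : ℝ} (hC : 0 ≤ C)
    (h : ∀ᵐ t, ‖f t‖ₑ ≤ G t) (hG : mixedLNorm p q G ≤ ENNReal.ofReal C) : ‖f‖ ≤ C := by
  rw [← ENNReal.ofReal_le_ofReal_iff hC, Lpq.ofReal_norm]
  exact (mixedLNorm_mono_ae hp.out hq.out h).trans hG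

theorem Lpq.coeFn_sub (f g : Lpq d p q) : ∀ᵐ t, (f - g) t = f t - g t :=
  AEEqFun.coeFn_sub f.1 g.1

theorem Lpq.coeFn_sum {ι : Type*} (s : Finset ι) (u : ι → Lpq d p q) :
    ∀ᵐ t, (∑ i ∈ s, u i : Lpq d p q) t = ∑ i ∈ s, u i t := by
  classical
  induction s using Finset.induction_on with
  | empty =>
    filter_upwards [AEEqFun.coeFn_zero (μ := (volume : Measure (E d))) (β := ℂ)] with t ht
    simp [ht]
  | insert i s hi ih =>
    rw [Finset.sum_insert hi]
    filter_upwards [ih, AEEqFun.coeFn_add (u i).1 (∑ i ∈ s, u i : Lpq d p q).1] with t h1 h2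
    rw [Finset.sum_insert hi, ← h1]
    exact h2

theorem MemLpq.coeFn_toLpq {f : E d → ℂ} (hf : MemLpq p q f) : ∀ᵐ t, hf.toLpq t = f t :=
  AEEqFun.coeFn_mk f hf.1

/-- Riesz–Fischer argument: an absolutely convergent series of classes converges pointwise almost
everywhere, and its tails are dominated by the tails of the series of norms. -/
instance Lpq.instCompleteSpace : CompleteSpace (Lpq d p q) := by
  refine NormedAddCommGroup.completeSpace_of_summable_imp_tendsto fun u hu => ?_
  have hm (n : ℕ) : Measurable fun t => ‖u n t‖ₑ := (u n).1.measurable.enorm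
  have htail (n : ℕ) : mixedLNorm p q (fun t => ∑' i, ‖u (i + n) t‖ₑ) ≤
      ENNReal.ofReal (∑' i, ‖u (i + n)‖) := by
    refine (mixedLNorm_tsum_le hp.out hq.out fun i => hm (i + n)).trans ?_
    rw [ENNReal.ofReal_tsum_of_nonneg (fun i => norm_nonneg _) ((summable_nat_add_iff n).2 hu)]
    exact le_of_eq (tsum_congr fun i => (Lpq.ofReal_norm _).symm)
  have hfin : ∀ᵐ t, ∑' i, ‖u i t‖ₑ < ∞ :=
    ae_lt_top_of_mixedLNorm_lt_top hp.out hq.out (Measurable.tsum hm)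
      ((htail 0).trans_lt ENNReal.ofReal_lt_top)
  have hsum : ∀ᵐ t, Summable fun i => u i t := by
    filter_upwards [hfin] with t ht
    exact (tsum_enorm_ne_top_iff_summable_norm.1 ht.ne).of_norm
  have hmeas : AEStronglyMeasurable (fun t => ∑' i, u i t) (volume : Measure (E d)) := by
    refine aestronglyMeasurable_of_tendsto_ae atTop
      (f := fun n t => ∑ i ∈ Finset.range n, u i t)
      (fun n => Finset.aestronglyMeasurable_fun_sum _ fun i _ => (u i).1.aestronglyMeasurable) ?_
    filter_upwards [hsum] with t ht
    exact ht.hasSum.tendsto_sum_nat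
  have hmem : MemLpq p q fun t => ∑' i, u i t :=
    ⟨hmeas, lt_of_le_of_lt (mixedLNorm_mono hp.out hq.out fun t => enorm_tsum_le_tsum_enorm)
      ((htail 0).trans_lt ENNReal.ofReal_lt_top)⟩
  refine ⟨hmem.toLpq, ?_⟩
  rw [tendsto_iff_norm_sub_tendsto_zero]
  refine squeeze_zero (fun _ => norm_nonneg _) (fun n => ?_)
    (tendsto_sum_nat_add fun i => ‖u i‖)
  refine Lpq.norm_le_of_ae_enorm_le (tsum_nonneg fun _ => norm_nonneg _) ?_ (htail n)
  filter_upwards [Lpq.coeFn_sub (∑ i ∈ Finset.range n, u i) hmem.toLpq,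
    Lpq.coeFn_sum (Finset.range n) u, hmem.coeFn_toLpq, hsum] with t h1 h2 h3 h4
  rw [h1, h2, h3, ← h4.sum_add_tsum_nat_add n, enorm_sub_rev, add_sub_cancel_left]
  exact enorm_tsum_le_tsum_enorm

end Complete

/-! ### The mixed sequence space as an iterated `lp` space. -/

section LpEnorm

variable {ι : Type*} {F : ι → Type*} [∀ i, NormedAddCommGroup (F i)] {s : ℝ}

instance fact_one_le_ofReal [hs : Fact (1 ≤ s)] : Fact (1 ≤ ENNReal.ofReal s) :=
  ⟨by simpa using ENNReal.ofReal_le_ofReal hs.out⟩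

theorem lp_tsum_enorm_rpow [hs1 : Fact (1 ≤ s)] (f : lp F (ENNReal.ofReal s)) :
    ∑' i, ‖f i‖ₑ ^ s = ENNReal.ofReal ‖f‖ ^ s := by
  have hs : 0 < s := lt_of_lt_of_le one_pos hs1.out
  have hs' : 0 < (ENNReal.ofReal s).toReal := by rwa [ENNReal.toReal_ofReal hs.le]
  have h := lp.hasSum_norm hs' f
  rw [ENNReal.toReal_ofReal hs.le] at h
  rw [ENNReal.ofReal_rpow_of_nonneg (norm_nonneg f) hs.le, ← h.tsum_eq,
    ENNReal.ofReal_tsum_of_nonneg (fun i => by positivity) h.summable]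
  refine tsum_congr fun i => ?_
  rw [← ofReal_norm, ENNReal.ofReal_rpow_of_nonneg (norm_nonneg _) hs.le]

theorem memℓp_of_tsum_enorm_rpow (hs : 0 < s) {f : ∀ i, F i} (h : ∑' i, ‖f i‖ₑ ^ s < ∞) :
    Memℓp f (ENNReal.ofReal s) := by
  have hs' : 0 < (ENNReal.ofReal s).toReal := by rwa [ENNReal.toReal_ofReal hs.le]
  refine (memℓp_gen_iff hs').2 ?_
  rw [ENNReal.toReal_ofReal hs.le]
  have := ENNReal.summable_toReal h.ne
  refine this.congr fun i => ?_
  rw [← ENNReal.toReal_rpow, toReal_enorm]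

end LpEnorm

/-- The mixed sequence space `ℓ^{p,q}`, as a Banach space. -/
abbrev SeqSpace (d : ℕ) (p q : ℝ) [Fact (1 ≤ q)] : Type :=
  lp (fun _ : ℤ => lp (fun _ : Fin d → ℤ => ℂ) (ENNReal.ofReal q)) (ENNReal.ofReal p)

/-- The families on the lattice underlying a tuple of elements of `ℓ^{p,q}`. -/
def coeff {d r : ℕ} {p q : ℝ} [Fact (1 ≤ q)] (x : Fin r → SeqSpace d p q) (i : Fin r) (k : Lat d) : ℂ :=
  x i k.1 k.2

section Seq

variable {d r : ℕ} {p q : ℝ} [hp : Fact (1 ≤ p)] [hq : Fact (1 ≤ q)]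

theorem seqSpace_tsum (x : SeqSpace d p q) :
    ∑' k₁ : ℤ, (∑' k₂ : Fin d → ℤ, ‖x k₁ k₂‖ₑ ^ q) ^ (p / q) = ENNReal.ofReal ‖x‖ ^ p := by
  have hp' : 0 < p := by linarith [hp.out, hq.out]
  have hq' : 0 < q := by linarith [hp.out, hq.out]
  rw [← lp_tsum_enorm_rpow x]
  refine tsum_congr fun n => ?_
  rw [lp_tsum_enorm_rpow (x n), ← ENNReal.rpow_mul, ofReal_norm]
  congr 1
  field_simp

theorem memSeq_coeff (x : Fin r → SeqSpace d p q) (i : Fin r) :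
    MemSeq p q (coeff x i) := by
  change ∑' k₁ : ℤ, (∑' k₂ : Fin d → ℤ, ‖x i k₁ k₂‖ₑ ^ q) ^ (p / q) < ∞
  rw [seqSpace_tsum]
  exact ENNReal.rpow_lt_top_of_nonneg (by linarith [hp.out, hq.out]) ENNReal.ofReal_ne_top

theorem exists_seqSpace_of_memSeq {c : Lat d → ℂ}
    (hc : MemSeq p q c) : ∃ x : SeqSpace d p q, ∀ k₁ k₂, x k₁ k₂ = c (k₁, k₂) := by
  have hp' : 0 < p := by linarith [hp.out, hq.out]
  have hq' : 0 < q := by linarith [hp.out, hq.out]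
  -- Finiteness of the outer sum forces each row to lie in $\ell^q$, since $p/q>0$.
  have h1 (n : ℤ) : ∑' k₂ : Fin d → ℤ, ‖c (n, k₂)‖ₑ ^ q < ∞ := by
    have := (ENNReal.le_tsum n).trans_lt hc
    exact (ENNReal.rpow_lt_top_iff_of_pos (div_pos hp' hq')).1 this
  let y (n : ℤ) : lp (fun _ : Fin d → ℤ => ℂ) (ENNReal.ofReal q) :=
    ⟨fun l => c (n, l), memℓp_of_tsum_enorm_rpow hq' (h1 n)⟩
  have h2 : ∑' n, ‖y n‖ₑ ^ p < ∞ := by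
    refine lt_of_eq_of_lt (tsum_congr fun n => ?_) hc
    have := lp_tsum_enorm_rpow (y n)
    change ∑' l, ‖c (n, l)‖ₑ ^ q = _ at this
    rw [this, ← ENNReal.rpow_mul, ofReal_norm]
    congr 1
    field_simp
  exact ⟨⟨y, memℓp_of_tsum_enorm_rpow hp' h2⟩, fun _ _ => rfl⟩

theorem norm_coeff_le (x : Fin r → SeqSpace d p q) (i : Fin r)
    (k : Lat d) : ‖coeff x i k‖ ≤ ‖x‖ := by
  have hp0 : ENNReal.ofReal p ≠ 0 := (ENNReal.ofReal_pos.2 (by linarith [hp.out, hq.out])).ne'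
  have hq0 : ENNReal.ofReal q ≠ 0 := (ENNReal.ofReal_pos.2 (by linarith [hp.out, hq.out])).ne'
  exact (lp.norm_apply_le_norm hq0 _ _).trans
    ((lp.norm_apply_le_norm hp0 _ _).trans (norm_le_pi_norm x i))

end Seq

/-! ### Lattice geometry. -/

section Box

variable {d : ℕ}

/-- The lattice points in a cube about the origin. -/
noncomputable def box (d N : ℕ) : Finset (Lat d) :=
  Finset.Icc (-(N : ℤ)) N ×ˢ Fintype.piFinset fun _ => Finset.Icc (-(N : ℤ)) N

theorem mem_box_of_norm_le {N : ℕ} {m : Lat d} (h : ‖m.toE‖ ≤ N) : m ∈ box d N := by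
  have h1 : |(m.1 : ℝ)| ≤ N := (norm_fst_le m.toE).trans h
  have h2 (i : Fin d) : |(m.2 i : ℝ)| ≤ N :=
    (PiLp.norm_apply_le m.toE.2 i).trans ((norm_snd_le m.toE).trans h)
  rw [abs_le] at h1
  simp only [abs_le] at h2
  simp only [box, Finset.mem_product, Fintype.mem_piFinset, Finset.mem_Icc]
  exact_mod_cast And.intro h1 h2

theorem Lat.toE_sub (k m : Lat d) : (k - m).toE = k.toE - m.toE := by
  refine Prod.ext ?_ ?_
  · simp [Lat.toE]
  · ext i
    simp [Lat.toE]

theorem norm_sub_latFloor_le (t : E d) : ‖t - (latFloor t).toE‖ ≤ 1 + d := by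
  have h0 (x : ℝ) : |x - ⌊x⌋| ≤ 1 := by
    rw [abs_le]
    constructor <;> linarith [Int.floor_le x, (Int.lt_floor_add_one x).le]
  refine max_le ((h0 t.1).trans (by simp)) ?_
  have h2 : ‖(t - (latFloor t).toE).2‖ ≤ √d := by
    rw [EuclideanSpace.norm_eq]
    refine Real.sqrt_le_sqrt ?_
    calc ∑ i, ‖(t - (latFloor t).toE).2 i‖ ^ 2 ≤ ∑ _i : Fin d, (1 : ℝ) :=
          Finset.sum_le_sum fun i _ => pow_le_one₀ (norm_nonneg _) (h0 (t.2 i))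
      _ = d := by simp
  refine h2.trans (Real.sqrt_le_iff.2 ⟨by positivity, ?_⟩)
  nlinarith [Nat.cast_nonneg (α := ℝ) d]

theorem latFloor_sub (t : E d) (m : Lat d) : latFloor (t - m.toE) = latFloor t - m := by
  refine Prod.ext ?_ ?_
  · simp [latFloor, Lat.toE]
  · ext i
    simp [latFloor, Lat.toE]

end Box

/-! ### Local bounds for functions generated by shifts. -/

section Generated

variable {d r : ℕ} {p q : ℝ}

/-- The function `∑_i ∑_k c_i(k) φ_i(· - k)`. -/
noncomputable def genFun (Φ : Fin r → E d → ℂ) (c : Fin r → Lat d → ℂ) (s : E d) : ℂ :=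
  ∑ i, ∑' k : Lat d, c i k * Φ i (s - k.toE)

/-- The sum of the absolute values of the coefficients near `t`. -/
noncomputable def coeffMajorant (N : ℕ) (c : Fin r → Lat d → ℂ) (t : E d) : ℝ≥0∞ :=
  ∑ i, ∑ m ∈ box d N, ‖c i (latFloor t - m)‖ₑ

/-- Compact support leaves only the shifts $k$ with $\lfloor t\rfloor-k$ in a fixed box. The index
set depends on $t$ alone and serves every $s$ within $D$ of $t$, so values at two nearby points can
be compared term by term, and no summability question arises. -/
theorem genFun_eq_sum {Φ : Fin r → E d → ℂ} {R D : ℝ} {N : ℕ}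
    (hR : ∀ i z, Φ i z ≠ 0 → ‖z‖ ≤ R) (hN : R + D + 1 + d ≤ N) (c : Fin r → Lat d → ℂ)
    {s t : E d} (hst : ‖s - t‖ ≤ D) :
    genFun Φ c s = ∑ i, ∑ m ∈ box d N,
      c i (latFloor t - m) * Φ i (s - (latFloor t - m).toE) := by
  classical
  refine Finset.sum_congr rfl fun i _ => ?_
  rw [tsum_eq_sum (s := (box d N).image fun m => latFloor t - m),
    Finset.sum_image fun _ _ _ _ h => sub_right_injective h]
  intro k hk
  by_contra hne
  refine hk (Finset.mem_image.2 ⟨latFloor t - k, mem_box_of_norm_le ?_, sub_sub_cancel _ _⟩)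
  have h1 := hR i _ (right_ne_zero_of_mul hne)
  have h2 := norm_sub_latFloor_le t
  rw [Lat.toE_sub]
  calc ‖(latFloor t).toE - k.toE‖
      = ‖(s - k.toE) - (s - t) - (t - (latFloor t).toE)‖ := by congr 1; abel
    _ ≤ ‖s - k.toE‖ + ‖s - t‖ + ‖t - (latFloor t).toE‖ :=
      (norm_sub_le _ _).trans (by gcongr; exact norm_sub_le _ _)
    _ ≤ N := by linarith

theorem measurable_coeffMajorant (N : ℕ) (c : Fin r → Lat d → ℂ) :
    Measurable (coeffMajorant N c) := by
  refine Finset.measurable_fun_sum _ fun i _ => Finset.measurable_fun_sum _ fun m _ => ?_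
  exact (measurable_of_countable fun k : Lat d => ‖c i (k - m)‖ₑ).comp measurable_latFloor

theorem measurable_genFun {Φ : Fin r → E d → ℂ} {R : ℝ} (hΦ : ∀ i, Continuous (Φ i))
    (hR : ∀ i z, Φ i z ≠ 0 → ‖z‖ ≤ R) (c : Fin r → Lat d → ℂ) : Measurable (genFun Φ c) := by
  obtain ⟨N, hN⟩ := exists_nat_ge (R + 0 + 1 + d)
  have h : genFun Φ c = fun t => ∑ i, ∑ m ∈ box d N,
      c i (latFloor t - m) * Φ i (t - (latFloor t - m).toE) :=
    funext fun t => genFun_eq_sum hR hN c (by simp)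
  rw [h]
  refine Finset.measurable_fun_sum _ fun i _ => Finset.measurable_fun_sum _ fun m _ => ?_
  refine ((measurable_of_countable fun k : Lat d => c i (k - m)).comp measurable_latFloor).mul ?_
  exact (hΦ i).measurable.comp (measurable_id.sub
    ((measurable_of_countable fun k : Lat d => (k - m).toE).comp measurable_latFloor))

theorem enorm_genFun_le {Φ : Fin r → E d → ℂ} {R D : ℝ} {N : ℕ} {B : ℝ≥0∞}
    (hR : ∀ i z, Φ i z ≠ 0 → ‖z‖ ≤ R) (hN : R + D + 1 + d ≤ N) (hB : ∀ i z, ‖Φ i z‖ₑ ≤ B)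
    (c : Fin r → Lat d → ℂ) {s t : E d} (hst : ‖s - t‖ ≤ D) :
    ‖genFun Φ c s‖ₑ ≤ B * coeffMajorant N c t := by
  rw [genFun_eq_sum hR hN c hst, coeffMajorant, Finset.mul_sum]
  refine (enorm_sum_le _ _).trans (Finset.sum_le_sum fun i _ => ?_)
  rw [Finset.mul_sum]
  refine (enorm_sum_le _ _).trans (Finset.sum_le_sum fun m _ => ?_)
  rw [enorm_mul, mul_comm]
  gcongr
  exact hB _ _

/-- Both values are expanded over the box attached to $t$, so the coefficients agree and the
difference falls on the generators. -/
theorem enorm_genFun_sub_le {Φ : Fin r → E d → ℂ} {R D δ : ℝ} {N : ℕ} {ε : ℝ≥0∞}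
    (hR : ∀ i z, Φ i z ≠ 0 → ‖z‖ ≤ R) (hN : R + D + 1 + d ≤ N) (hD : 0 ≤ D) (hδD : δ ≤ D)
    (hδ : ∀ i z w, ‖z - w‖ ≤ δ → ‖Φ i z - Φ i w‖ₑ ≤ ε)
    (c : Fin r → Lat d → ℂ) {s t : E d} (hst : ‖s - t‖ ≤ δ) :
    ‖genFun Φ c s - genFun Φ c t‖ₑ ≤ ε * coeffMajorant N c t := by
  rw [genFun_eq_sum hR hN c (hst.trans hδD), genFun_eq_sum hR hN c (s := t) (t := t) (by simpa),
    coeffMajorant, Finset.mul_sum, ← Finset.sum_sub_distrib]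
  refine (enorm_sum_le _ _).trans (Finset.sum_le_sum fun i _ => ?_)
  rw [Finset.mul_sum, ← Finset.sum_sub_distrib]
  refine (enorm_sum_le _ _).trans (Finset.sum_le_sum fun m _ => ?_)
  rw [← mul_sub, enorm_mul, mul_comm]
  gcongr
  refine hδ _ _ _ ?_
  simpa using hst

/-- Each term of the majorant is a lattice translate of a cellwise constant function, whose mixed
norm is that of one coefficient family; the factor counts the terms. -/
theorem mixedLNorm_coeffMajorant_le [hp : Fact (1 ≤ p)] [hq : Fact (1 ≤ q)] (N : ℕ)
    (x : Fin r → SeqSpace d p q) :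
    mixedLNorm p q (coeffMajorant N (coeff x)) ≤
      ENNReal.ofReal (r * (box d N).card * ‖x‖) := by
  have hm (i : Fin r) (m : Lat d) : Measurable fun t : E d => ‖coeff x i (latFloor t - m)‖ₑ :=
    (measurable_of_countable fun k : Lat d => ‖coeff x i (k - m)‖ₑ).comp measurable_latFloor
  have h1 (i : Fin r) (m : Lat d) :
      mixedLNorm p q (fun t : E d => ‖coeff x i (latFloor t - m)‖ₑ) ≤ ENNReal.ofReal ‖x‖ := by
    have h2 : (fun t : E d => ‖coeff x i (latFloor t - m)‖ₑ) =
        fun t => (fun t : E d => ‖coeff x i (latFloor t)‖ₑ) (t + -m.toE) := by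
      funext t
      rw [← latFloor_sub, sub_eq_add_neg]
    rw [h2, mixedLNorm_comp_add (fun t : E d => ‖coeff x i (latFloor t)‖ₑ) (-m.toE),
      mixedLNorm_comp_latFloor fun k => ‖coeff x i k‖ₑ]
    simp only [coeff]
    rw [seqSpace_tsum, ← ENNReal.rpow_mul, mul_one_div_cancel (by linarith [hp.out]),
      ENNReal.rpow_one]
    exact ENNReal.ofReal_le_ofReal (norm_le_pi_norm x i)
  unfold coeffMajorant
  calc mixedLNorm p q (fun t : E d => ∑ i, ∑ m ∈ box d N, ‖coeff x i (latFloor t - m)‖ₑ)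
      ≤ ∑ i, mixedLNorm p q (fun t : E d => ∑ m ∈ box d N, ‖coeff x i (latFloor t - m)‖ₑ) :=
        mixedLNorm_sum_le hp.out hq.out _ fun i => Finset.measurable_fun_sum _ fun m _ => hm i m
    _ ≤ ∑ i : Fin r, ∑ m ∈ box d N, ENNReal.ofReal ‖x‖ := by
        refine Finset.sum_le_sum fun i _ => ?_
        exact (mixedLNorm_sum_le hp.out hq.out _ (hm i)).trans (Finset.sum_le_sum fun m _ => h1 i m)
    _ = ENNReal.ofReal (r * (box d N).card * ‖x‖) := by
        rw [ENNReal.ofReal_mul (by positivity), ENNReal.ofReal_mul (by positivity)]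
        simp [mul_assoc]

end Generated

/-! ### The synthesis operator and stable choice of coefficients. -/

section Synthesis

variable {d r : ℕ} {p q : ℝ} [hp : Fact (1 ≤ p)] [hq : Fact (1 ≤ q)]

theorem memLpq_genFun {Φ : Fin r → E d → ℂ} {R B : ℝ} (hΦ : ∀ i, Continuous (Φ i))
    (hR : ∀ i z, Φ i z ≠ 0 → ‖z‖ ≤ R) (hB : ∀ i z, ‖Φ i z‖ₑ ≤ ENNReal.ofReal B)
    (x : Fin r → SeqSpace d p q) : MemLpq p q (genFun Φ (coeff x)) := by
  obtain ⟨N, hN⟩ := exists_nat_ge (R + 0 + 1 + d)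
  refine ⟨(measurable_genFun hΦ hR _).aestronglyMeasurable, ?_⟩
  refine (mixedLNorm_mono hp.out hq.out fun t =>
    enorm_genFun_le hR hN hB (coeff x) (s := t) (t := t) (by simp)).trans_lt ?_
  rw [mixedLNorm_const_mul hp.out hq.out _ (measurable_coeffMajorant N _)]
  exact ENNReal.mul_lt_top ENNReal.ofReal_lt_top
    ((mixedLNorm_coeffMajorant_le N x).trans_lt ENNReal.ofReal_lt_top)

/-- Synthesis is made a bounded operator between Banach spaces so that the open mapping theorem can
be applied to it. -/
theorem exists_synthesis {Φ : Fin r → E d → ℂ} {R B : ℝ} (hΦ : ∀ i, Continuous (Φ i))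
    (hR : ∀ i z, Φ i z ≠ 0 → ‖z‖ ≤ R) (hB0 : 0 ≤ B)
    (hB : ∀ i z, ‖Φ i z‖ₑ ≤ ENNReal.ofReal B) :
    ∃ T : (Fin r → SeqSpace d p q) →L[ℂ] Lpq d p q,
      ∀ x, ∀ᵐ t, T x t = genFun Φ (coeff x) t := by
  obtain ⟨N, hN⟩ := exists_nat_ge (R + 0 + 1 + d)
  have hmem := memLpq_genFun (p := p) (q := q) hΦ hR hB
  let T : (Fin r → SeqSpace d p q) →ₗ[ℂ] Lpq d p q :=
    { toFun := fun x => (hmem x).toLpq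
      map_add' := fun x y => by
        refine Subtype.ext (AEEqFun.ext ?_)
        filter_upwards [(hmem (x + y)).coeFn_toLpq, (hmem x).coeFn_toLpq,
          (hmem y).coeFn_toLpq, AEEqFun.coeFn_add (hmem x).toLpq.1 (hmem y).toLpq.1]
          with t h1 h2 h3 h4
        rw [h1]
        refine Eq.trans ?_ h4.symm
        rw [Pi.add_apply, h2, h3]
        simp only [genFun_eq_sum hR hN _ (s := t) (t := t) (by simp)]
        simp [coeff, add_mul, Finset.sum_add_distrib]
      map_smul' := fun a x => by
        refine Subtype.ext (AEEqFun.ext ?_)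
        filter_upwards [(hmem (a • x)).coeFn_toLpq, (hmem x).coeFn_toLpq,
          AEEqFun.coeFn_smul a (hmem x).toLpq.1] with t h1 h2 h4
        rw [h1]
        refine Eq.trans ?_ h4.symm
        rw [Pi.smul_apply, h2]
        simp only [genFun_eq_sum hR hN _ (s := t) (t := t) (by simp)]
        simp [coeff, Finset.mul_sum, mul_assoc] }
  refine ⟨T.mkContinuous (B * (r * (box d N).card)) fun x => ?_, fun x => (hmem x).coeFn_toLpq⟩
  refine Lpq.norm_le_of_ae_enorm_le (G := fun t => ENNReal.ofReal B * coeffMajorant N (coeff x) t)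
    (by positivity) ?_ ?_
  · filter_upwards [(hmem x).coeFn_toLpq] with t ht
    exact (congrArg _ ht).trans_le (enorm_genFun_le hR hN hB (coeff x) (by simp))
  · rw [mixedLNorm_const_mul hp.out hq.out _ (measurable_coeffMajorant N _), mul_assoc,
      ENNReal.ofReal_mul hB0]
    gcongr
    exact mixedLNorm_coeffMajorant_le N x

/-- Stability of the generators: if the shift-invariant space is the range of a bounded
projection, the coefficients of its elements can be chosen with controlled norm. -/
theorem exists_coeff_norm_le {Φ : Fin r → E d → ℂ} {R B : ℝ} (hΦ : ∀ i, Continuous (Φ i))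
    (hR : ∀ i z, Φ i z ≠ 0 → ‖z‖ ≤ R) (hB0 : 0 ≤ B)
    (hB : ∀ i z, ‖Φ i z‖ₑ ≤ ENNReal.ofReal B) {P : Lpq d p q →L[ℂ] Lpq d p q}
    (hP : IsProjectionOnto P (shiftInvSpace p q Φ)) :
    ∃ C > 0, ∀ g ∈ shiftInvSpace p q Φ, ∃ x : Fin r → SeqSpace d p q,
      (∀ᵐ t, g t = genFun Φ (coeff x) t) ∧ ‖x‖ ≤ C * ‖g‖ := by
  obtain ⟨T, hT⟩ := exists_synthesis (p := p) (q := q) hΦ hR hB0 hB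
  have hfix : ∀ f, f ∈ shiftInvSpace p q Φ ↔ P f = f := fun f => by
    rw [← hP.2]
    exact ⟨by rintro ⟨g, rfl⟩; exact hP.1 g, fun h => ⟨f, h⟩⟩
  -- As the kernel of $P-I$ the space is visibly a closed subspace, hence complete.
  let V : Submodule ℂ (Lpq d p q) := (P - ContinuousLinearMap.id ℂ (Lpq d p q)).ker
  have hV : ∀ f, f ∈ V ↔ f ∈ shiftInvSpace p q Φ := fun f => by
    rw [hfix]
    simp [V, LinearMap.mem_ker, sub_eq_zero]
  have hTV : ∀ x, T x ∈ V := fun x =>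
    (hV _).2 ⟨coeff x, memSeq_coeff x, hT x⟩
  have : CompleteSpace V :=
    (ContinuousLinearMap.isClosed_ker (P - ContinuousLinearMap.id ℂ (Lpq d p q))).completeSpace_coe
  -- Open mapping theorem for the synthesis map onto $V$; the coefficients need not be unique.
  obtain ⟨C, hC, h⟩ := (T.codRestrict V hTV).exists_preimage_norm_le fun g => by
    obtain ⟨c, hc, hg⟩ := (hV _).1 g.2
    choose x hx using fun i => exists_seqSpace_of_memSeq (hc i)
    refine ⟨x, Subtype.ext (Subtype.ext (AEEqFun.ext ?_))⟩
    have hxc : coeff x = c := by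
      funext i k
      exact hx i k.1 k.2
    filter_upwards [hT x, hg] with t h1 h2
    rw [h2]
    refine Eq.trans h1 ?_
    rw [hxc, genFun]
  refine ⟨C, hC, fun g hg => ?_⟩
  obtain ⟨x, hx, hn⟩ := h ⟨g, (hV g).2 hg⟩
  refine ⟨x, ?_, hn⟩
  have : T x = g := congrArg Subtype.val hx
  rw [← this]
  exact hT x

end Synthesis

/-! ### Average samples and the mass of the averaging function. -/

section Samples

variable {d : ℕ}

instance isAddHaarMeasure_volume : (volume : Measure (E d)).IsAddHaarMeasure := by
  rw [Measure.volume_eq_prod]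
  infer_instance

theorem finrank_E : Module.finrank ℝ (E d) = d + 1 := by
  simp [E, add_comm]

/-- Substitute $t=(x,y)+au$: the Jacobian $a^{d+1}$ cancels the normalisation of the dilation. -/
theorem sample_eq_integral {a : ℝ} (ha : 0 < a) (ψ f : E d → ℂ) (x : ℝ)
    (y : EuclideanSpace ℝ (Fin d)) :
    sample a ψ f x y = ∫ u, f ((x, y) + a • u) * (starRingEnd ℂ) (ψ u) := by
  have ha' : a ^ (d + 1) ≠ 0 := by positivity
  unfold sample
  rw [← integral_add_right_eq_self (sampleIntegrand a ψ f x y) ((x, y) : E d)]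
  have h := Measure.integral_comp_smul_of_nonneg (volume : Measure (E d))
    (fun v => sampleIntegrand a ψ f x y (v + (x, y))) a (hR := ha.le)
  rw [finrank_E] at h
  rw [← smul_inv_smul₀ ha' (∫ v, sampleIntegrand a ψ f x y (v + (x, y))), ← h, ← integral_smul]
  refine integral_congr_ae (ae_of_all _ fun u => ?_)
  have h1 : (1 / a) • ((x, y) + a • u - (x, y)) = u := by
    rw [add_sub_cancel_left, smul_smul, one_div_mul_cancel ha.ne', one_smul]
  have h2 : (a : ℂ) ^ (d + 1) ≠ 0 := by exact_mod_cast ha'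
  simp only [sampleIntegrand, dilate, map_mul, Complex.conj_ofReal, Complex.real_smul,
    add_comm (a • u)]
  rw [h1]
  push_cast
  field_simp

theorem integrable_dilate {a : ℝ} (ha : 0 < a) {ψ : E d → ℂ} (hψ : Integrable ψ) :
    Integrable (dilate a ψ) :=
  (hψ.comp_smul (one_div_pos.2 ha).ne').const_mul _

theorem integrable_sampleIntegrand {a : ℝ} (ha : 0 < a) {ψ f : E d → ℂ} (hψ : Integrable ψ)
    (hf : AEStronglyMeasurable f (volume : Measure (E d))) {C : ℝ} (hC : ∀ᵐ t, ‖f t‖ ≤ C)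
    (x : ℝ) (y : EuclideanSpace ℝ (Fin d)) : Integrable (sampleIntegrand a ψ f x y) := by
  have h : Integrable fun t => (starRingEnd ℂ) (dilate a ψ (t - (x, y))) :=
    (LinearIsometryEquiv.integrable_comp_iff Complex.conjLIE).2
      ((integrable_dilate ha hψ).comp_sub_right ((x, y) : E d))
  exact h.bdd_mul hf hC

theorem sample_congr {a : ℝ} {ψ f g : E d → ℂ} (h : ∀ᵐ t, f t = g t) (x : ℝ)
    (y : EuclideanSpace ℝ (Fin d)) : sample a ψ f x y = sample a ψ g x y := by
  refine integral_congr_ae ?_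
  filter_upwards [h] with t ht
  simp only [sampleIntegrand, ht]

theorem norm_sample_le {a : ℝ} (ha : 0 < a) {ψ f : E d → ℂ} (hψ : Integrable ψ) {C : ℝ}
    (hC : ∀ t, ‖f t‖ ≤ C) (x : ℝ) (y : EuclideanSpace ℝ (Fin d)) :
    ‖sample a ψ f x y‖ ≤ C * ∫ u, ‖ψ u‖ := by
  rw [sample_eq_integral ha, ← integral_const_mul]
  refine norm_integral_le_of_norm_le (hψ.norm.const_mul C) (ae_of_all _ fun u => ?_)
  rw [norm_mul, RCLike.norm_conj]
  exact mul_le_mul_of_nonneg_right (hC _) (norm_nonneg _)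

/-- Because $\int\overline\psi=1$, the constant $v$ is its own average and can be moved under the
integral. -/
theorem enorm_sample_sub_le {a : ℝ} (ha : 0 < a) {ψ f : E d → ℂ} (hψ : Integrable ψ)
    (hψ1 : ∫ u, ψ u = 1) (hf : Measurable f) {C : ℝ} (hC : ∀ t, ‖f t‖ ≤ C) (x : ℝ)
    (y : EuclideanSpace ℝ (Fin d)) (v : ℂ) :
    ‖sample a ψ f x y - v‖ₑ ≤ ∫⁻ u, ‖f ((x, y) + a • u) - v‖ₑ * ‖ψ u‖ₑ := by
  have hconj : Integrable fun u => (starRingEnd ℂ) (ψ u) :=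
    (LinearIsometryEquiv.integrable_comp_iff Complex.conjLIE).2 hψ
  have h1 : v = ∫ u, v * (starRingEnd ℂ) (ψ u) := by
    rw [integral_const_mul, integral_conj, hψ1, map_one, mul_one]
  have hm : Measurable fun u : E d => f ((x, y) + a • u) := hf.comp (by fun_prop)
  rw [sample_eq_integral ha]
  nth_rw 1 [h1]
  rw [← integral_sub (hconj.bdd_mul hm.aestronglyMeasurable (ae_of_all _ fun u => hC _))
    (hconj.const_mul v)]
  refine (enorm_integral_le_lintegral_enorm _).trans (lintegral_mono fun u => ?_)
  rw [← sub_mul, enorm_mul, ← ofReal_norm (starRingEnd ℂ (ψ u)), RCLike.norm_conj, ofReal_norm]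

/-- The mass of `|ψ|` on the cells of the lattice. -/
noncomputable def cellMass (ψ : E d → ℂ) (l : Lat d) : ℝ≥0∞ :=
  (volume.withDensity fun u => ‖ψ u‖ₑ).map latFloor {l}

/-- Push the measure $|\psi|\,du$ forward to the countable lattice, where integrals are sums. -/
theorem lintegral_comp_latFloor_mul {ψ : E d → ℂ} (hψ : Measurable ψ) (κ : Lat d → ℝ≥0∞) :
    ∫⁻ u, κ (latFloor u) * ‖ψ u‖ₑ = ∑' l, κ l * cellMass ψ l := by
  have hκ : Measurable κ := measurable_of_countable κ
  unfold cellMass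
  rw [← lintegral_countable', lintegral_map hκ measurable_latFloor]
  refine Eq.trans ?_ (lintegral_withDensity_eq_lintegral_mul _ hψ.enorm
    (hκ.comp measurable_latFloor)).symm
  simp only [Pi.mul_apply, mul_comm, Function.comp_apply]

theorem tsum_cellMass {ψ : E d → ℂ} (hψ : Measurable ψ) :
    ∑' l, cellMass ψ l = ∫⁻ u, ‖ψ u‖ₑ := by
  simpa using (lintegral_comp_latFloor_mul hψ fun _ => 1).symm

end Samples

/-! ### Oscillation over near and far cells. -/

theorem exists_finset_tsum_compl_le {ι : Type*} {w : ι → ℝ≥0∞} (hw : ∑' i, w i ≠ ∞)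
    {η : ℝ≥0∞} (hη : 0 < η) :
    ∃ s : Finset ι, ∑' i, (sᶜ : Set ι).indicator w i ≤ η := by
  obtain ⟨s, hs⟩ := ((ENNReal.tendsto_tsum_compl_atTop_zero hw).eventually_le_const hη).exists
  exact ⟨s, by rwa [← tsum_subtype]⟩

section Oscillation

variable {d r : ℕ}

open Classical in
/-- The bound of the oscillation of a generated function over a cell, near the origin and far
from it. -/
noncomputable def oscBound (S : Finset (Lat d)) (N : ℕ) (ε B : ℝ≥0∞) (c : Fin r → Lat d → ℂ)
    (a : ℝ) (l : Lat d) (t : E d) : ℝ≥0∞ :=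
  if l ∈ S then ε * coeffMajorant N c t
  else B * (coeffMajorant N c (t + a • l.toE) + coeffMajorant N c t)

theorem measurable_oscBound (S : Finset (Lat d)) (N : ℕ) (ε B : ℝ≥0∞) (c : Fin r → Lat d → ℂ)
    (a : ℝ) (l : Lat d) : Measurable (oscBound S N ε B c a l) := by
  have h := measurable_coeffMajorant N c
  have h' : Measurable fun t : E d => coeffMajorant N c (t + a • l.toE) :=
    h.comp (measurable_id.add_const _)
  unfold oscBound
  split_ifs
  · exact h.const_mul _
  · exact (h'.add h).const_mul _

/-- By Minkowski each cell counts separately. A far cell costs only $2B$ times its mass, however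
distant it is, because translation preserves the mixed norm. -/
theorem mixedLNorm_tsum_oscBound_le {p q : ℝ} (hp : 1 ≤ p) (hq : 1 ≤ q) (S : Finset (Lat d))
    (N : ℕ) (ε B : ℝ≥0∞) (c : Fin r → Lat d → ℂ) (a : ℝ) (w : Lat d → ℝ≥0∞) :
    mixedLNorm p q (fun t => ∑' l, oscBound S N ε B c a l t * w l) ≤
      (ε * ∑' l, w l + 2 * B * ∑' l, (Sᶜ : Set (Lat d)).indicator w l) *
        mixedLNorm p q (coeffMajorant N c) := by
  have hm (l : Lat d) : Measurable fun t => oscBound S N ε B c a l t * w l :=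
    (measurable_oscBound S N ε B c a l).mul_const _
  have h := measurable_coeffMajorant N c
  refine (mixedLNorm_tsum_le hp hq hm).trans ?_
  rw [← ENNReal.tsum_mul_left, ← ENNReal.tsum_mul_left, ← ENNReal.tsum_add,
    ← ENNReal.tsum_mul_right]
  refine ENNReal.tsum_le_tsum fun l => ?_
  simp only [mul_comm _ (w l)]
  rw [mixedLNorm_const_mul hp hq _ (measurable_oscBound S N ε B c a l)]
  by_cases hl : l ∈ S
  · have : oscBound S N ε B c a l = fun t => ε * coeffMajorant N c t := by
      funext t
      simp [oscBound, hl]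
    rw [this, mixedLNorm_const_mul hp hq _ h, ← mul_assoc]
    gcongr
    exact le_self_add
  · have h' : Measurable fun t : E d => coeffMajorant N c (t + a • l.toE) :=
      h.comp (measurable_id.add_const _)
    have : oscBound S N ε B c a l = fun t =>
        B * (coeffMajorant N c (t + a • l.toE) + coeffMajorant N c t) := by
      funext t
      simp [oscBound, hl]
    have hadd : Measurable fun t => coeffMajorant N c (t + a • l.toE) + coeffMajorant N c t :=
      h'.add h
    rw [this, mixedLNorm_const_mul hp hq _ hadd]
    have h2 := mixedLNorm_add_le hp hq h' h
    rw [mixedLNorm_comp_add, ← two_mul] at h2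
    have h3 : (Sᶜ : Set (Lat d)).indicator w l = w l := Set.indicator_of_mem (by simpa using hl) _
    rw [h3]
    calc w l * (B * mixedLNorm p q
          fun t => coeffMajorant N c (t + a • l.toE) + coeffMajorant N c t)
        ≤ w l * (B * (2 * mixedLNorm p q (coeffMajorant N c))) := by gcongr
      _ = 2 * B * w l * mixedLNorm p q (coeffMajorant N c) := by ring
      _ ≤ _ := by
        gcongr
        exact le_add_self

theorem coeffMajorant_le {p q : ℝ} [Fact (1 ≤ p)] [Fact (1 ≤ q)] (N : ℕ)
    (x : Fin r → SeqSpace d p q) (t : E d) :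
    coeffMajorant N (coeff x) t ≤ ENNReal.ofReal (r * (box d N).card * ‖x‖) := by
  calc coeffMajorant N (coeff x) t ≤ ∑ i : Fin r, ∑ m ∈ box d N, ENNReal.ofReal ‖x‖ := by
        refine Finset.sum_le_sum fun i _ => Finset.sum_le_sum fun m _ => ?_
        rw [← ofReal_norm]
        exact ENNReal.ofReal_le_ofReal (norm_coeff_le x i _)
    _ = _ := by
        rw [ENNReal.ofReal_mul (by positivity), ENNReal.ofReal_mul (by positivity)]
        simp [mul_assoc]

/-- The generated function oscillates little on the scale of the sampling and of the averages. -/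
theorem enorm_genFun_sub_le_oscBound {Φ : Fin r → E d → ℂ} {R δ L a ρ : ℝ} {N : ℕ} {ε B : ℝ≥0∞}
    (hR : ∀ i z, Φ i z ≠ 0 → ‖z‖ ≤ R) (hN : R + (2 + d) + 1 + d ≤ N)
    (hB : ∀ i z, ‖Φ i z‖ₑ ≤ B) (hδ1 : δ ≤ 1)
    (hδ : ∀ i z w, ‖z - w‖ ≤ δ → ‖Φ i z - Φ i w‖ₑ ≤ ε) {S : Finset (Lat d)}
    (hS : ∀ l ∈ S, ‖l.toE‖ ≤ L) (ha : 0 ≤ a) (ha1 : a ≤ 1) (hρ1 : ρ ≤ 1)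
    (haρ : ρ + a * (L + 1 + d) ≤ δ) (c : Fin r → Lat d → ℂ) {t z : E d} (htz : ‖z - t‖ ≤ ρ)
    (u : E d) :
    ‖genFun Φ c (z + a • u) - genFun Φ c t‖ₑ ≤ oscBound S N ε B c a (latFloor u) t := by
  have hu := norm_sub_latFloor_le u
  unfold oscBound
  split_ifs with hl
  -- Near cell: $\|u\|\le L+1+d$, so the total displacement stays within the modulus $\delta$.
  · refine enorm_genFun_sub_le hR hN (by positivity)
      (hδ1.trans (by linarith [Nat.cast_nonneg (α := ℝ) d])) hδ c ?_
    have h1 : ‖u‖ ≤ L + 1 + d := by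
      calc ‖u‖ = ‖(latFloor u).toE + (u - (latFloor u).toE)‖ := by congr 1; abel
        _ ≤ ‖(latFloor u).toE‖ + ‖u - (latFloor u).toE‖ := norm_add_le _ _
        _ ≤ L + 1 + d := by linarith [hS _ hl]
    calc ‖z + a • u - t‖ = ‖(z - t) + a • u‖ := by congr 1; abel
      _ ≤ ‖z - t‖ + ‖a • u‖ := norm_add_le _ _
      _ ≤ ρ + a * (L + 1 + d) := by
        rw [norm_smul, Real.norm_of_nonneg ha]
        gcongr
      _ ≤ δ := haρ
  -- Far cell: the first value is bounded from the base point $t+a\lfloor u\rfloor$, at distance at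
  -- most $2+d$ from $z+au$. The bound thus depends on the cell of $u$ only.
  · refine (enorm_sub_le).trans ?_
    rw [mul_add]
    refine add_le_add (enorm_genFun_le hR hN hB c ?_)
      (enorm_genFun_le hR hN hB c (by simpa using (by positivity)))
    calc ‖z + a • u - (t + a • (latFloor u).toE)‖
        = ‖(z - t) + a • (u - (latFloor u).toE)‖ := by rw [smul_sub]; congr 1; abel
      _ ≤ ‖z - t‖ + ‖a • (u - (latFloor u).toE)‖ := norm_add_le _ _
      _ ≤ 1 + 1 * (1 + d) := by
        rw [norm_smul, Real.norm_of_nonneg ha]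
        gcongr
        exact htz.trans hρ1
      _ = 2 + d := by ring

end Oscillation

/-! ### Convex combinations formed by a partition of unity. -/

section Averages

variable {d : ℕ}

theorem norm_sub_le_of_mem_eball {x : ℝ} {y : EuclideanSpace ℝ (Fin d)} {ρ : ℝ} {t : E d}
    (h : t ∈ eball x y ρ) : ‖(x, y) - t‖ ≤ ρ := by
  have h' : √((t.1 - x) ^ 2 + ‖t.2 - y‖ ^ 2) ≤ ρ := le_of_lt h
  refine max_le ?_ ?_
  · rw [Prod.fst_sub, norm_sub_rev]
    exact (Real.abs_le_sqrt (by nlinarith [sq_nonneg ‖t.2 - y‖])).trans h'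
  · rw [Prod.snd_sub, norm_sub_rev]
    exact (Real.le_sqrt_of_sq_le (by nlinarith [sq_nonneg (t.1 - x)])).trans h'

variable {J : Type*} {a ρ : ℝ} {ψ f : E d → ℂ} {x : J → ℝ} {y : J → EuclideanSpace ℝ (Fin d)}
  {β : J → J → E d → ℝ}

theorem IsBUPU.mem_eball (hβ : IsBUPU ρ x y β) {j k : J} {t : E d} (h : β j k t ≠ 0) :
    t ∈ eball (x j) (y k) ρ :=
  hβ.tsupport_subset j k (subset_tsupport _ h)

theorem IsBUPU.summable_mul (hβ : IsBUPU ρ x y β) {s : J × J → ℂ} {C : ℝ} (hs : ∀ i, ‖s i‖ ≤ C)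
    (t : E d) : Summable fun jk : J × J => s jk * (β jk.1 jk.2 t : ℂ) := by
  refine ((hβ.hasSum_one t).summable.mul_left C).of_norm_bounded fun jk => ?_
  rw [norm_mul, Complex.norm_real, Real.norm_of_nonneg (hβ.nonneg _ _ _)]
  exact mul_le_mul_of_nonneg_right (hs _) (hβ.nonneg _ _ _)

/-- The weights sum to one, so $v$ can be distributed over them; only indices whose ball contains
$t$ have nonzero weight. -/
theorem IsBUPU.enorm_tsum_sub_le (hβ : IsBUPU ρ x y β) {s : J × J → ℂ} {C : ℝ}
    (hs : ∀ i, ‖s i‖ ≤ C) {t : E d} {v : ℂ} {G : ℝ≥0∞}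
    (hG : ∀ j k, t ∈ eball (x j) (y k) ρ → ‖s (j, k) - v‖ₑ ≤ G) :
    ‖∑' jk : J × J, s jk * (β jk.1 jk.2 t : ℂ) - v‖ₑ ≤ G := by
  have h1 : HasSum (fun jk : J × J => (β jk.1 jk.2 t : ℂ)) 1 := by
    simpa using Complex.hasSum_ofReal.2 (hβ.hasSum_one t)
  have h2 : v = ∑' jk : J × J, v * (β jk.1 jk.2 t : ℂ) := by
    rw [tsum_mul_left, h1.tsum_eq, mul_one]
  nth_rw 1 [h2]
  rw [← (hβ.summable_mul hs t).tsum_sub (h1.summable.mul_left v)]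
  refine enorm_tsum_le_tsum_enorm.trans ?_
  have h3 : ∑' jk : J × J, ENNReal.ofReal (β jk.1 jk.2 t) = 1 := by
    rw [← ENNReal.ofReal_tsum_of_nonneg (fun jk => hβ.nonneg _ _ _) (hβ.hasSum_one t).summable,
      (hβ.hasSum_one t).tsum_eq, ENNReal.ofReal_one]
  calc ∑' jk : J × J, ‖s jk * (β jk.1 jk.2 t : ℂ) - v * (β jk.1 jk.2 t : ℂ)‖ₑ
      ≤ ∑' jk : J × J, G * ENNReal.ofReal (β jk.1 jk.2 t) := by
        refine ENNReal.tsum_le_tsum fun jk => ?_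
        by_cases h0 : β jk.1 jk.2 t = 0
        · simp [h0]
        · rw [← sub_mul, enorm_mul, ← ofReal_norm (β jk.1 jk.2 t : ℂ), Complex.norm_real,
            Real.norm_of_nonneg (hβ.nonneg _ _ _)]
          gcongr
          exact hG _ _ (hβ.mem_eball h0)
    _ = G := by rw [ENNReal.tsum_mul_left, h3, mul_one]

end Averages

/-! ### The averaging operator is close to the identity. -/

section Approximation

variable {d r : ℕ} {p q : ℝ} [hp : Fact (1 ≤ p)] [hq : Fact (1 ≤ q)]

/-- The averaging operators approximate the identity on the shift-invariant space. -/
theorem exists_avgOp_sub_norm_le {Φ : Fin r → E d → ℂ} (hΦ : ∀ i, Continuous (Φ i)) {R B : ℝ}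
    (hR : ∀ i z, Φ i z ≠ 0 → ‖z‖ ≤ R) (hB0 : 0 ≤ B)
    (hB : ∀ i z, ‖Φ i z‖ₑ ≤ ENNReal.ofReal B) (hΦu : ∀ i, UniformContinuous (Φ i))
    {ψ : E d → ℂ} (hψc : Continuous ψ) (hψ : Integrable ψ) (hψ1 : ∫ t, ψ t = 1)
    {τ : ℝ} (hτ : 0 < τ) :
    ∃ ρ₀ > 0, ∃ a₀ > 0, ∀ (a ρ : ℝ), 0 < a → a ≤ a₀ → ρ ≤ ρ₀ →
      ∀ (J : Type*) [Countable J] (x : J → ℝ) (y : J → EuclideanSpace ℝ (Fin d))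
        (β : J → J → E d → ℝ), IsBUPU ρ x y β →
      ∀ (X : Fin r → SeqSpace d p q) (g : Lpq d p q), (∀ᵐ t, g t = genFun Φ (coeff X) t) →
        AvgDefined p q a ψ x y β g ∧ ‖avgOp a ψ x y β g - g‖ ≤ τ * ‖X‖ := by
  obtain ⟨N, hN⟩ := exists_nat_ge (R + (2 + d) + 1 + d)
  set A : ℝ := r * (box d N).card with hA
  have hA0 : 0 ≤ A := by positivity
  have hW : ∑' l, cellMass ψ l ≠ ∞ := by
    rw [tsum_cellMass hψc.measurable]
    exact hψ.2.ne
  set W : ℝ := (∑' l, cellMass ψ l).toReal with hWdef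
  have hW0 : 0 ≤ W := ENNReal.toReal_nonneg
  -- With $W$ the mass of $|\psi|$ and $A$ the norm factor of the majorant, $\varepsilon$ and $\eta$
  -- make the near and far contributions at most $\tau/2$ each. The added ones avoid division by
  -- zero.
  set ε : ℝ := τ / (2 * (W + 1) * (A + 1)) with hε
  have hε0 : 0 < ε := by positivity
  set η : ℝ := τ / (4 * (B + 1) * (A + 1)) with hη
  have hη0 : 0 < η := by positivity
  have hsmall : (ε * W + 2 * B * η) * A ≤ τ := by
    have h1 : ε * W * A ≤ τ / 2 := by
      have : ε * W * A = τ / 2 * ((W / (W + 1)) * (A / (A + 1))) := by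
        rw [hε]; field_simp
      rw [this]
      refine mul_le_of_le_one_right (by positivity) (mul_le_one₀ ?_ (by positivity) ?_)
      · exact (div_le_one (by positivity)).2 (by linarith)
      · exact (div_le_one (by positivity)).2 (by linarith)
    have h2 : 2 * B * η * A ≤ τ / 2 := by
      have : 2 * B * η * A = τ / 2 * ((B / (B + 1)) * (A / (A + 1))) := by
        rw [hη]; field_simp; ring
      rw [this]
      refine mul_le_of_le_one_right (by positivity) (mul_le_one₀ ?_ (by positivity) ?_)
      · exact (div_le_one (by positivity)).2 (by linarith)
      · exact (div_le_one (by positivity)).2 (by linarith)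
    linarith
  obtain ⟨S, hS⟩ := exists_finset_tsum_compl_le hW (ENNReal.ofReal_pos.2 hη0)
  obtain ⟨L, hL0, hL⟩ : ∃ L : ℝ, 0 ≤ L ∧ ∀ l ∈ S, ‖l.toE‖ ≤ L :=
    ⟨∑ l ∈ S, ‖l.toE‖, Finset.sum_nonneg fun _ _ => norm_nonneg _, fun l hl =>
      Finset.single_le_sum (f := fun l : Lat d => ‖l.toE‖) (fun _ _ => norm_nonneg _) hl⟩
  obtain ⟨δ, hδ0, hδ1, hδ⟩ : ∃ δ > 0, δ ≤ 1 ∧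
      ∀ i z w, ‖z - w‖ ≤ δ → ‖Φ i z - Φ i w‖ₑ ≤ ENNReal.ofReal ε := by
    have h (i : Fin r) := Metric.uniformContinuous_iff.1 (hΦu i) ε hε0
    choose δ' hδ'0 hδ' using h
    -- A common modulus taken from the neighbourhoods of $0$, which also covers an empty family of
    -- generators.
    obtain ⟨m, hm0, hm⟩ : ∃ m > 0, ∀ i, m < δ' i := by
      have := (Filter.eventually_all (l := 𝓝[>] (0 : ℝ))).2 fun i =>
        (eventually_lt_nhds (hδ'0 i)).filter_mono nhdsWithin_le_nhds
      obtain ⟨m, hm, hm0⟩ := (this.and self_mem_nhdsWithin).exists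
      exact ⟨m, hm0, hm⟩
    refine ⟨min m 1, by positivity, min_le_right _ _, fun i z w hzw => ?_⟩
    rw [← ofReal_norm]
    refine ENNReal.ofReal_le_ofReal ?_
    rw [← dist_eq_norm]
    refine (hδ' i ?_).le
    rw [dist_eq_norm]
    exact hzw.trans_lt ((min_le_left _ _).trans_lt (hm i))
  have hLd : 0 < L + 1 + d := by positivity
  -- Half of $\delta$ is allotted to the distance from the sampling point, half to the averaging
  -- displacement $a(L+1+d)$.
  refine ⟨δ / 2, by positivity, min 1 (δ / (2 * (L + 1 + d))), by positivity, ?_⟩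
  intro a ρ ha haa hρ J _ x y β hβ X g hg
  have haρ : ρ + a * (L + 1 + d) ≤ δ := by
    have h1 : a * (L + 1 + d) ≤ δ / 2 := by
      have := mul_le_mul_of_nonneg_right (haa.trans (min_le_right _ _)) hLd.le
      have h2 : δ / (2 * (L + 1 + d)) * (L + 1 + d) = δ / 2 := by field_simp
      linarith
    linarith
  set G : E d → ℝ≥0∞ := fun t => ∑' l, oscBound S N (ENNReal.ofReal ε) (ENNReal.ofReal B)
    (coeff X) a l t * cellMass ψ l with hG
  have hGnorm : mixedLNorm p q G ≤ ENNReal.ofReal (τ * ‖X‖) := by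
    refine (mixedLNorm_tsum_oscBound_le hp.out hq.out S N _ _ (coeff X) a _).trans ?_
    calc _ ≤ (ENNReal.ofReal ε * ENNReal.ofReal W
            + 2 * ENNReal.ofReal B * ENNReal.ofReal η) * ENNReal.ofReal (A * ‖X‖) := by
          rw [hWdef, ENNReal.ofReal_toReal hW]
          gcongr
          exact mixedLNorm_coeffMajorant_le N X
      _ = ENNReal.ofReal ((ε * W + 2 * B * η) * A * ‖X‖) := by
          have h2 : (2 : ℝ≥0∞) = ENNReal.ofReal 2 := by simp
          rw [h2, ← ENNReal.ofReal_mul hε0.le, ← ENNReal.ofReal_mul zero_le_two,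
            ← ENNReal.ofReal_mul (by positivity), ← ENNReal.ofReal_add (by positivity)
            (by positivity), ← ENNReal.ofReal_mul (by positivity), mul_assoc _ A]
      _ ≤ ENNReal.ofReal (τ * ‖X‖) := by gcongr
  set f : E d → ℂ := genFun Φ (coeff X) with hf
  have hfm : Measurable f := measurable_genFun hΦ hR _
  have hfb (t : E d) : ‖f t‖ ≤ B * (A * ‖X‖) := by
    rw [← ENNReal.ofReal_le_ofReal_iff (by positivity), ofReal_norm, ENNReal.ofReal_mul hB0]
    refine (enorm_genFun_le hR hN hB (coeff X) (s := t) (t := t) (by simp; positivity)).trans ?_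
    gcongr
    exact coeffMajorant_le N X t
  -- Samples ignore null sets, so the everywhere defined generated function replaces the chosen
  -- representative.
  have hsample (j k : J) : sample a ψ g (x j) (y k) = sample a ψ f (x j) (y k) :=
    sample_congr hg _ _
  have hbound (jk : J × J) : ‖sample a ψ g (x jk.1) (y jk.2)‖ ≤
      B * (A * ‖X‖) * ∫ u, ‖ψ u‖ := by
    rw [hsample]
    exact norm_sample_le ha hψ hfb _ _
  have havg (t : E d) : ‖avgFun a ψ x y β g t - f t‖ₑ ≤ G t := by
    refine hβ.enorm_tsum_sub_le (s := fun jk => sample a ψ g (x jk.1) (y jk.2)) hbound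
      fun j k hjk => ?_
    rw [hsample]
    refine (enorm_sample_sub_le ha hψ hψ1 hfm hfb _ _ _).trans ?_
    rw [hG]
    simp only
    rw [← lintegral_comp_latFloor_mul hψc.measurable fun l => oscBound S N (ENNReal.ofReal ε)
      (ENNReal.ofReal B) (coeff X) a l t]
    refine lintegral_mono fun u => ?_
    gcongr
    exact enorm_genFun_sub_le_oscBound hR hN hB hδ1 hδ hL ha.le (haa.trans (min_le_left _ _))
      (hρ.trans (by linarith)) haρ (coeff X) (norm_sub_le_of_mem_eball hjk) u
  have hdef : AvgDefined p q a ψ x y β g := by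
    refine ⟨fun j k => integrable_sampleIntegrand ha hψ g.1.aestronglyMeasurable
      (C := B * (A * ‖X‖)) ?_ _ _, fun t => ?_, ?_, ?_⟩
    · filter_upwards [hg] with t ht
      rw [ht]
      exact hfb t
    · exact hβ.summable_mul (s := fun jk => sample a ψ g (x jk.1) (y jk.2)) hbound t
    · refine Measurable.aestronglyMeasurable (Measurable.tsum fun jk => ?_)
      exact (Complex.measurable_ofReal.comp (hβ.measurable jk.1 jk.2)).const_mul _
    · have hGm : Measurable G :=
        Measurable.tsum fun l => (measurable_oscBound S N _ _ (coeff X) a l).mul_const _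
      have h1 (t : E d) : ‖avgFun a ψ x y β g t‖ₑ ≤ ‖f t‖ₑ + G t := by
        calc ‖avgFun a ψ x y β g t‖ₑ = ‖f t + (avgFun a ψ x y β g t - f t)‖ₑ := by
              rw [add_sub_cancel]
          _ ≤ ‖f t‖ₑ + G t := (enorm_add_le _ _).trans (by gcongr; exact havg t)
      refine (mixedLNorm_mono hp.out hq.out h1).trans_lt ?_
      refine (mixedLNorm_add_le hp.out hq.out hfm.enorm hGm).trans_lt ?_
      exact ENNReal.add_lt_top.2 ⟨(memLpq_genFun hΦ hR hB X).2,
        hGnorm.trans_lt ENNReal.ofReal_lt_top⟩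
  refine ⟨hdef, Lpq.norm_le_of_ae_enorm_le (by positivity) (G := G) ?_ hGnorm⟩
  have hop : avgOp a ψ x y β g = hdef.memLpq.toLpq := dif_pos hdef
  filter_upwards [Lpq.coeFn_sub (avgOp a ψ x y β g) g, hdef.memLpq.coeFn_toLpq, hg]
    with t h1 h2 h3
  rw [h1, hop, h2, h3]
  exact havg t

end Approximation

/-! ### Existence of partitions of unity. -/

section PartitionOfUnity

variable {d : ℕ}

theorem continuous_eball_dist (x : ℝ) (y : EuclideanSpace ℝ (Fin d)) :
    Continuous fun t : E d => √((t.1 - x) ^ 2 + ‖t.2 - y‖ ^ 2) := by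
  fun_prop

/-- Enumerate the balls and assign each point to the first ball containing it. Using a radius
$\rho'$ strictly between $\gamma$ and $\rho$ keeps the closed supports inside the open balls of
radius $\rho$. -/
theorem exists_isBUPU {J : Type*} [Countable J] {γ ρ : ℝ} {x : J → ℝ}
    {y : J → EuclideanSpace ℝ (Fin d)} (h : IsDenseSampling γ x y) (hρ : γ < ρ) :
    ∃ β, IsBUPU ρ x y β := by
  classical
  obtain ⟨ρ', hγρ', hρ'⟩ := exists_between hρ
  have : Encodable (J × J) := Encodable.ofCountable _
  let U (i : J × J) : Set (E d) := eball (x i.1) (y i.2) ρ'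
  let V (i : J × J) : Set (E d) := U i \ ⋃ i' ∈ {i' | Encodable.encode i' < Encodable.encode i}, U i'
  have hU (i : J × J) : MeasurableSet (U i) :=
    (isOpen_lt (continuous_eball_dist _ _) continuous_const).measurableSet
  have hV (i : J × J) : MeasurableSet (V i) :=
    (hU i).diff (MeasurableSet.biUnion (Set.to_countable _) fun i' _ => hU i')
  have hex (t : E d) : ∃ n, ∃ i, Encodable.encode i = n ∧ t ∈ U i := by
    have ht : t ∈ ⋃ j, ⋃ k, eball (x j) (y k) ρ' := by
      rw [h ρ' hγρ']
      trivial
    simp only [Set.mem_iUnion] at ht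
    obtain ⟨j, k, hjk⟩ := ht
    exact ⟨_, (j, k), rfl, hjk⟩
  have huniq (t : E d) : ∃ i₀, ∀ i, t ∈ V i ↔ i = i₀ := by
    obtain ⟨i₀, hi₀, ht⟩ := Nat.find_spec (hex t)
    have hmin : ∀ i, t ∈ U i → Encodable.encode i₀ ≤ Encodable.encode i := fun i hi =>
      hi₀ ▸ Nat.find_min' (hex t) ⟨i, rfl, hi⟩
    refine ⟨i₀, fun i => ⟨fun hi => ?_, ?_⟩⟩
    · have h1 : ¬ Encodable.encode i₀ < Encodable.encode i := fun hlt =>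
        hi.2 (Set.mem_biUnion hlt ht)
      exact Encodable.encode_injective (le_antisymm (not_lt.1 h1) (hmin i hi.1))
    · rintro rfl
      refine ⟨ht, fun hmem => ?_⟩
      simp only [Set.mem_iUnion] at hmem
      obtain ⟨i', hi', hti'⟩ := hmem
      exact absurd (hmin i' hti') (not_le.2 hi')
  refine ⟨fun j k => (V (j, k)).indicator 1, ?_, ?_, ?_, ?_, ?_⟩
  · exact fun j k => measurable_one.indicator (hV _)
  · exact fun j k t => Set.indicator_nonneg (fun _ _ => zero_le_one) t
  · exact fun j k t => Set.indicator_le_self' (fun _ _ => zero_le_one) t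
  · intro j k
    refine (closure_minimal (t := {t : E d | √((t.1 - x j) ^ 2 + ‖t.2 - y k‖ ^ 2) ≤ ρ'}) ?_
      (isClosed_le (continuous_eball_dist _ _) continuous_const)).trans fun t ht =>
        lt_of_le_of_lt ht hρ'
    intro t ht
    have hlt : √((t.1 - x j) ^ 2 + ‖t.2 - y k‖ ^ 2) < ρ' := (Set.mem_of_indicator_ne_zero ht).1
    exact hlt.le
  · intro t
    obtain ⟨i₀, hi₀⟩ := huniq t
    have h1 : (V i₀).indicator (1 : E d → ℝ) t = 1 := by
      rw [Set.indicator_of_mem ((hi₀ i₀).2 rfl), Pi.one_apply]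
    have h2 := hasSum_single (f := fun i : J × J => (V i).indicator (1 : E d → ℝ) t) i₀
      fun i hi => Set.indicator_of_notMem (mt (hi₀ i).1 hi) _
    simpa only [h1] using h2

end PartitionOfUnity

/-! ### Convergence of the iteration and assembly. -/

/-- No linearity of $A$ is needed: each error lies in $V$, and the next one is $g-PAg=P(g-Ag)$ with
$g$ the current error. -/
theorem tendsto_and_norm_sub_le_of_contraction {F : Type*} [NormedAddCommGroup F]
    [NormedSpace ℂ F] {P : F →L[ℂ] F} {V : Set F} (hP : IsProjectionOnto P V) {A : F → F}
    {κ : ℝ} (hκ : 0 ≤ κ) (hA : ∀ g ∈ V, ‖P‖ * ‖A g - g‖ ≤ κ * ‖g‖) (hκ1 : κ < 1) {f : F}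
    (hf : f ∈ V) {u : ℕ → F} (hu1 : u 1 = P (A f))
    (hu : ∀ n, 1 ≤ n → u (n + 1) = P (A (f - u n)) + u n) :
    Tendsto u atTop (𝓝 f) ∧ ∀ n, 1 ≤ n → ‖f - u n‖ ≤ ‖f‖ * κ ^ n := by
  have hfix : ∀ g, g ∈ V ↔ P g = g := fun g => by
    rw [← hP.2]
    exact ⟨by rintro ⟨g, rfl⟩; exact hP.1 g, fun h => ⟨g, h⟩⟩
  have hstep : ∀ g ∈ V, ‖g - P (A g)‖ ≤ κ * ‖g‖ := fun g hg => by
    calc ‖g - P (A g)‖ = ‖P (A g - g)‖ := by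
          rw [map_sub, (hfix g).1 hg, norm_sub_rev]
      _ ≤ ‖P‖ * ‖A g - g‖ := P.le_opNorm _
      _ ≤ κ * ‖g‖ := hA g hg
  have key : ∀ n, 1 ≤ n → f - u n ∈ V ∧ ‖f - u n‖ ≤ ‖f‖ * κ ^ n := by
    intro n hn
    induction n, hn using Nat.le_induction with
    | base =>
      rw [hu1, hfix, map_sub, hP.1, (hfix f).1 hf]
      exact ⟨rfl, (hstep f hf).trans_eq (by ring)⟩
    | succ n hn ih =>
      have h1 : f - u (n + 1) = (f - u n) - P (A (f - u n)) := by
        rw [hu n hn]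
        abel
      rw [h1]
      refine ⟨?_, (hstep _ ih.1).trans ?_⟩
      · rw [hfix, map_sub, hP.1, (hfix _).1 ih.1]
      · calc κ * ‖f - u n‖ ≤ κ * (‖f‖ * κ ^ n) := by gcongr; exact ih.2
          _ = ‖f‖ * κ ^ (n + 1) := by ring
  refine ⟨?_, fun n hn => (key n hn).2⟩
  rw [tendsto_iff_norm_sub_tendsto_zero]
  have hlim : Tendsto (fun n : ℕ => ‖f‖ * κ ^ n) atTop (𝓝 0) := by
    simpa using (tendsto_pow_atTop_nhds_zero_of_lt_one hκ hκ1).const_mul ‖f‖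
  refine squeeze_zero' (Eventually.of_forall fun _ => norm_nonneg _) ?_ hlim
  filter_upwards [eventually_ge_atTop 1] with n hn
  rw [norm_sub_rev]
  exact (key n hn).2

theorem exists_common_bounds {d r : ℕ} {Φ : Fin r → E d → ℂ} (hΦ : ∀ i, Continuous (Φ i))
    (hΦc : ∀ i, HasCompactSupport (Φ i)) :
    ∃ R B : ℝ, 0 ≤ B ∧ (∀ i z, Φ i z ≠ 0 → ‖z‖ ≤ R) ∧
      ∀ i z, ‖Φ i z‖ₑ ≤ ENNReal.ofReal B := by
  choose R hR using fun i => (hΦc i).isCompact.isBounded.exists_norm_le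
  choose B hB using fun i => (hΦc i).exists_bound_of_continuous (hΦ i)
  refine ⟨∑ i, |R i|, ∑ i, |B i|, Finset.sum_nonneg fun _ _ => abs_nonneg _, fun i z hz => ?_,
    fun i z => ?_⟩
  · exact (hR i z (subset_tsupport _ hz)).trans ((le_abs_self _).trans
      (Finset.single_le_sum (f := fun i => |R i|) (fun _ _ => abs_nonneg _) (Finset.mem_univ i)))
  · rw [← ofReal_norm]
    exact ENNReal.ofReal_le_ofReal ((hB i z).trans ((le_abs_self _).trans
      (Finset.single_le_sum (f := fun i => |B i|) (fun _ _ => abs_nonneg _) (Finset.mem_univ i))))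

end MixedSampling

theorem theorem3p1 (d r : ℕ) (p q : ℝ) [Fact (1 ≤ p)] [Fact (1 ≤ q)]
    (Φ : Fin r → MixedSampling.E d → ℂ)
    (hΦ : ∀ i, MixedSampling.MemW0 1 1 (Φ i))
    (hΦc : ∀ i, HasCompactSupport (Φ i))
    (ψ : MixedSampling.E d → ℂ)
    (hψ : MixedSampling.MemW0 1 1 ψ)
    (hψ1 : ∫ t, ψ t = 1)
    (K : ℝ) :
    ∃ γ₀ : ℝ, 0 < γ₀ ∧ ∃ ρ₀ : ℝ, γ₀ < ρ₀ ∧ ∃ a₀ : ℝ, 0 < a₀ ∧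
      ∀ P : MixedSampling.Lpq d p q →L[ℂ] MixedSampling.Lpq d p q,
        MixedSampling.IsProjectionOnto P (MixedSampling.shiftInvSpace p q Φ) → ‖P‖ ≤ K →
      ∀ γ ≤ γ₀, ∀ a : ℝ, 0 < a → a ≤ a₀ →
      ∃ α : ℝ, 0 ≤ α ∧ α < 1 ∧
      ∀ f ∈ MixedSampling.shiftInvSpace p q Φ,
      ∃ M : ℝ,
      ∀ (J : Type*) [Countable J] (x : J → ℝ) (y : J → EuclideanSpace ℝ (Fin d)),
        MixedSampling.IsDenseSampling γ x y →
        (∀ ρ > γ, ∃ β, MixedSampling.IsBUPU ρ x y β) ∧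
        ∀ ρ ≤ ρ₀, ∀ β, MixedSampling.IsBUPU ρ x y β →
          (∀ g ∈ MixedSampling.shiftInvSpace p q Φ,
            MixedSampling.AvgDefined p q a ψ x y β g) ∧
          ∀ F : ℕ → MixedSampling.Lpq d p q,
            F 1 = P (MixedSampling.avgOp a ψ x y β f) →
            (∀ n, 1 ≤ n → F (n + 1) = P (MixedSampling.avgOp a ψ x y β (f - F n)) + F n) →
            Filter.Tendsto F Filter.atTop (nhds f) ∧
            ∀ n, 1 ≤ n → ‖f - F n‖ ≤ M * α ^ n := by
  -- Without any bounded projection the claim is vacuous. Otherwise one projection $P_0$ yields the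
  -- constant $C$, which concerns only the space and therefore serves every $P$.
  by_cases hex : ∃ P : MixedSampling.Lpq d p q →L[ℂ] MixedSampling.Lpq d p q,
    MixedSampling.IsProjectionOnto P (MixedSampling.shiftInvSpace p q Φ)
  swap
  · exact ⟨1, one_pos, 2, one_lt_two, 1, one_pos, fun P hP => absurd ⟨P, hP⟩ hex⟩
  obtain ⟨P₀, hP₀⟩ := hex
  have hcont (i : Fin r) : Continuous (Φ i) := (hΦ i).1
  obtain ⟨R, B, hB0, hR, hB⟩ := MixedSampling.exists_common_bounds hcont hΦc
  obtain ⟨C, hC0, hC⟩ := MixedSampling.exists_coeff_norm_le hcont hR hB0 hB hP₀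
  -- A non-integrable function has integral $0$ by convention, not $1$.
  have hψi : Integrable ψ := not_imp_comm.1 integral_undef (by rw [hψ1]; exact one_ne_zero)
  -- This $\tau$ makes $\|P\|\,\tau\,C\le 1/2$ whenever $\|P\|\le K$; $|K|+1$ keeps the denominator
  -- positive for any real $K$.
  obtain ⟨ρ₀, hρ₀, a₀, ha₀, h⟩ := MixedSampling.exists_avgOp_sub_norm_le (p := p) (q := q) hcont
    hR hB0 hB (fun i => (hΦc i).uniformContinuous_of_continuous (hcont i)) hψ.1 hψi hψ1
    (τ := 1 / (2 * (|K| + 1) * C)) (by positivity)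
  refine ⟨ρ₀ / 2, by positivity, ρ₀, by linarith, a₀, ha₀, ?_⟩
  intro P hP hPK γ _ a ha haa
  refine ⟨1 / 2, by norm_num, by norm_num, fun f hf => ⟨‖f‖, ?_⟩⟩
  intro J _ x y hdense
  refine ⟨fun ρ hρ => MixedSampling.exists_isBUPU hdense hρ, fun ρ hρ β hβ => ⟨?_, ?_⟩⟩
  · intro g hg
    obtain ⟨X, hX, -⟩ := hC g hg
    exact (h a ρ ha haa hρ J x y β hβ X g hX).1
  · intro F hF1 hF
    refine MixedSampling.tendsto_and_norm_sub_le_of_contraction hP (by norm_num)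
      (fun g hg => ?_) (by norm_num) hf hF1 hF
    obtain ⟨X, hX, hXn⟩ := hC g hg
    have h1 := (h a ρ ha haa hρ J x y β hβ X g hX).2
    calc ‖P‖ * ‖MixedSampling.avgOp a ψ x y β g - g‖
        ≤ (|K| + 1) * (1 / (2 * (|K| + 1) * C) * (C * ‖g‖)) := by
          gcongr
          · linarith [le_abs_self K]
          · exact h1.trans (by gcongr)
      _ = 1 / 2 * ‖g‖ := by field_simp
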